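/- Throughout, a cube $Q\subset\mathbb R^n$ has sides parallel to the axes, is half-open, $Q=\prod_{i=1}^n[a_i,a_i+\ell)$ with $\ell>0$, and $|E|$ is the Lebesgue measure of $E$; write $\langle g\rangle_Q=\frac1{|Q|}\int_Q g\,dx$. A dyadic grid is a collection $\mathcal D$ of cubes whose side lengths are integer powers of $2$, such that for each $k\in\mathbb Z$ the cubes in $\mathcal D$ of side length $2^k$ form a partition of $\mathbb R^n$, and any two cubes in $\mathcal D$ are disjoint or nested. A subset $\mathcal S\subset\mathcal D$ is sparse if for every $Q\in\mathcal S$ there is a measurable set $E_Q\subset Q$ with $|Q|\le 2|E_Q|$, the sets $E_Q$, $Q\in\mathcal S$, being pairwise disjoint. For $g\ge 0$ and $0<\alpha<n$ let $$A^\alpha_{\mathcal S}g(x)=\sum_{Q\in\mathcal S}|Q|^{\alpha/n}\langle g\rangle_Q\,\chi_Q(x)\in[0,\infty].$$ Let $0<\alpha<n$ and $1\le p<n/\alpha$, and define $q$ by $\frac1p-\frac1q=\frac\alpha n$; let $p'=\frac p{p-1}$ if $p>1$. A weight is a measurable function $w$ on $\mathbb R^n$ with $0<w<\infty$ almost everywhere.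 It belongs to $A_{p,q}$ if $[w]_{A_{p,q}}<\infty$, where, with suprema over all cubes, $$[w]_{A_{p,q}}=\sup_Q\,\langle w^q\rangle_Q\,\langle w^{-p'}\rangle_Q^{q/p'}\quad(p>1),\qquad [w]_{A_{1,q}}=\sup_Q\,\Big(\operatorname*{ess\,sup}_{x\in Q}w(x)^{-q}\Big)\langle w^q\rangle_Q .$$ The Fujii–Wilson characteristic of a locally integrable weight $v$ is $$[v]_{A_\infty}=\sup_Q\frac1{\int_Q v\,dx}\int_Q M(v\chi_Q)\,dx,\qquad Mf(x)=\sup_{Q\ni x}\langle|f|\rangle_Q.$$ **Theorem.** Let $\alpha,p,q$ be as above. There is a finite constant $C=C(n,\alpha,p)$ such that for every dyadic grid $\mathcal D$, every sparse $\mathcal S\subset\mathcal D$, every $w\in A_{p,q}$, every non-negative $f\in L^p(\mathbb R^n)$ and every $\lambda>0$, $$\big|\{x\in\mathbb R^n:\ w(x)\,A^\alpha_{\mathcal S}(fw^{-1})(x)>\lambda\}\big|\ \le\ C\,[w]_{A_{p,q}}\,[w^q]_{A_\infty}^q\left(\frac{\|f\|_{L^p}}{\lambda}\right)^q .$$ 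-/

import Mathlib

open MeasureTheory
open scoped ENNReal NNReal

namespace SparseFractional

/-- A cube in `ℝⁿ` with sides parallel to the coordinate axes, given by its lower corner and its
(positive) side length. -/
structure Cube (n : ℕ) where
  corner : Fin n → ℝ
  side : ℝ
  side_pos : 0 < side

/-- The half-open set of points `∏ᵢ [aᵢ, aᵢ + ℓ)` of a cube. -/
def Cube.toSet {n : ℕ} (Q : Cube n) : Set (Fin n → ℝ) :=
  {x | ∀ i, Q.corner i ≤ x i ∧ x i < Q.corner i + Q.side}

/-- A dyadic grid: all side lengths are integer powers of `2`, the cubes of each fixed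
side length `2 ^ k` form a partition of `ℝⁿ`, and any two cubes are either disjoint or nested. -/
structure IsDyadicGrid {n : ℕ} (D : Set (Cube n)) : Prop where
  side_eq : ∀ Q ∈ D, ∃ k : ℤ, Q.side = (2 : ℝ) ^ k
  partition : ∀ (k : ℤ) (x : Fin n → ℝ), ∃! Q : Cube n, Q ∈ D ∧ Q.side = (2 : ℝ) ^ k ∧ x ∈ Q.toSet
  nested : ∀ P ∈ D, ∀ Q ∈ D,
    P.toSet ∩ Q.toSet = ∅ ∨ P.toSet ⊆ Q.toSet ∨ Q.toSet ⊆ P.toSet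

/-- A family of cubes is sparse: every `Q` in it has a measurable subset `E Q` with
`|Q| ≤ 2 |E Q|`, and the sets `E Q` are pairwise disjoint. -/
def IsSparse {n : ℕ} (S : Set (Cube n)) : Prop :=
  ∃ E : Cube n → Set (Fin n → ℝ),
    (∀ Q ∈ S, MeasurableSet (E Q) ∧ E Q ⊆ Q.toSet ∧ volume Q.toSet ≤ 2 * volume (E Q)) ∧
    S.PairwiseDisjoint E

/-- The fractional sparse operator `A^α_S g (x) = ∑_{Q ∈ S} |Q|^{α/n} ⟨g⟩_Q χ_Q(x)` on
non-negative functions `g`, with values in `[0, ∞]`. -/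
noncomputable def fractionalSparse {n : ℕ} (S : Set (Cube n)) (α : ℝ)
    (g : (Fin n → ℝ) → ℝ≥0∞) (x : Fin n → ℝ) : ℝ≥0∞ :=
  ∑' Q : S, (Q : Cube n).toSet.indicator
    (fun _ => volume (Q : Cube n).toSet ^ (α / (n : ℝ)) *
      ⨍⁻ y in (Q : Cube n).toSet, g y ∂volume) x

/-- A weight: a measurable function that is positive (and finite) almost everywhere. -/
def IsWeight {n : ℕ} (w : (Fin n → ℝ) → ℝ) : Prop :=
  AEMeasurable w volume ∧ ∀ᵐ x ∂(volume : Measure (Fin n → ℝ)), 0 < w x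

/-- The characteristic `[w]_{A_{p,q}}`, where `p' = p / (p - 1)`; for `p = 1` the second average
is replaced by an essential supremum. -/
noncomputable def apqChar {n : ℕ} (p q : ℝ) (w : (Fin n → ℝ) → ℝ) : ℝ≥0∞ :=
  if p = 1 then
    ⨆ Q : Cube n,
      essSup (fun x => ENNReal.ofReal (w x) ^ (-q)) (volume.restrict Q.toSet) *
        ⨍⁻ x in Q.toSet, ENNReal.ofReal (w x) ^ q ∂volume
  else
    ⨆ Q : Cube n,
      (⨍⁻ x in Q.toSet, ENNReal.ofReal (w x) ^ q ∂volume) *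
        (⨍⁻ x in Q.toSet, ENNReal.ofReal (w x) ^ (-(p / (p - 1))) ∂volume) ^ (q / (p / (p - 1)))

/-- The class `A_{p,q}`. -/
def MemApq {n : ℕ} (p q : ℝ) (w : (Fin n → ℝ) → ℝ) : Prop :=
  IsWeight w ∧ apqChar p q w < ∞

/-- The (uncentered) Hardy--Littlewood maximal function over cubes. -/
noncomputable def maximalFn {n : ℕ} (f : (Fin n → ℝ) → ℝ) (x : Fin n → ℝ) : ℝ≥0∞ :=
  ⨆ Q : Cube n, Q.toSet.indicator (fun _ => ⨍⁻ y in Q.toSet, ‖f y‖ₑ ∂volume) x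

/-- The Fujii--Wilson characteristic
`[v]_{A_∞} = sup_Q (1 / v(Q)) ∫_Q M(v χ_Q)` of a (locally integrable) weight `v`. -/
noncomputable def ainftyChar {n : ℕ} (v : (Fin n → ℝ) → ℝ) : ℝ≥0∞ :=
  ⨆ Q : Cube n,
    (∫⁻ x in Q.toSet, maximalFn (Q.toSet.indicator v) x ∂volume) /
      ∫⁻ x in Q.toSet, ENNReal.ofReal (v x) ∂volume

end SparseFractional

/-! Put `u = w ^ q`, `J = ∫ f ^ p`, `a Q = |Q|^{α/n} ⟨f w⁻¹⟩_Q`, and let `G` be the level set above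
`l`, first for a finite subfamily. Integrating over `G` gives `l |G| ≤ ∑ a Q ∫_{Q ∩ G} u^{1/q}`. By
Hölder (an essential supremum if `p = 1`), `a Q ⟨u⟩_Q^{1/q} ≤ [w]^{1/q} fracAvg Q`, so what remains
is to compare `∫_{Q ∩ G} u^{1/q}` with `⟨u⟩_Q^{1/q} |Q|` and to sum.

The `A_∞` condition enters through `volume_level_le`: with an integer `N` comparable to `[u]_{A_∞}`
and `b = 2 · 2^{1/N}`, the set where `u > 2^k ⟨u⟩_Q` has measure at most `2 b^{-k} |Q|` in `Q`. This
is the sharp reverse Hölder inequality in distributional form, proved by stopping cubes.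

Sort the cubes by the density of `G`, writing `|Q ∩ G| ≈ b^{-m} |Q|`. On such a cube `∫_{Q ∩ G}
u^{1/q}` is at most a constant times `b^{-m} 2^{m/q} ⟨u⟩_Q^{1/q} |Q|` (`setLIntegral_rpow_le`). The
cubes of class `m` cover a set of measure at most `b^{m+1} |G|`, and the weak type bound of the
fractional maximal operator with Kolmogorov's inequality bounds `∑ fracAvg Q |Q|` by a constant
times `J^{1/p} (b^{m+1} |G|)^{1-1/q}` (`sum_fracAvg_mul_volume_le`).

In the product the powers of `b` and `2` combine to `(2/b)^{m/q} = 2^{-m/(Nq)}`, whose sum over `m`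
is at most `2Nq`: the characteristic enters linearly. Dividing by `|G|^{1-1/q}` and raising to the
power `q` gives the bound for finite sums, and continuity of measure gives it for the whole family.
-/

namespace SparseFractional

/-! ### Cubes and countability of sparse families -/

variable {n : ℕ}

theorem Cube.toSet_eq_pi (Q : Cube n) :
    Q.toSet = Set.univ.pi fun i => Set.Ico (Q.corner i) (Q.corner i + Q.side) := by
  ext x; simp [Cube.toSet]

theorem Cube.measurableSet (Q : Cube n) : MeasurableSet Q.toSet := by
  rw [Q.toSet_eq_pi]
  exact MeasurableSet.univ_pi fun _ => measurableSet_Ico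

theorem Cube.volume_eq (Q : Cube n) : volume Q.toSet = ENNReal.ofReal Q.side ^ n := by
  rw [Q.toSet_eq_pi, Real.volume_pi_Ico]
  simp

theorem Cube.volume_ne_zero (Q : Cube n) : volume Q.toSet ≠ 0 := by
  rw [Q.volume_eq]
  exact pow_ne_zero _ (by simpa using Q.side_pos)

theorem Cube.volume_ne_top (Q : Cube n) : volume Q.toSet ≠ ∞ := by
  rw [Q.volume_eq]
  exact ENNReal.pow_ne_top ENNReal.ofReal_ne_top

theorem Cube.corner_mem (Q : Cube n) : Q.corner ∈ Q.toSet :=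
  fun _ => ⟨le_rfl, by linarith [Q.side_pos]⟩

theorem Cube.side_le_of_subset (hn : n ≠ 0) {P Q : Cube n} (h : P.toSet ⊆ Q.toSet) :
    P.side ≤ Q.side := by
  have := measure_mono (μ := volume) h
  rw [P.volume_eq, Q.volume_eq] at this
  exact (ENNReal.ofReal_le_ofReal_iff Q.side_pos.le).1 ((ENNReal.pow_le_pow_left_iff hn).1 this)

theorem countable_of_pairwiseDisjoint_toSet {T : Set (Cube n)}
    (h : T.PairwiseDisjoint Cube.toSet) : T.Countable := by
  have h1 := Measure.countable_meas_pos_of_disjoint_iUnion (μ := (volume : Measure (Fin n → ℝ)))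
    (As := fun Q : T => (Q : Cube n).toSet) (fun Q => Q.1.measurableSet)
    (fun P Q hPQ => h P.2 Q.2 (fun e => hPQ (Subtype.ext e)))
  have h2 : {i : T | 0 < volume (i : Cube n).toSet} = Set.univ := by
    ext Q; simpa using pos_iff_ne_zero.2 Q.1.volume_ne_zero
  rw [h2] at h1
  exact Set.countable_coe_iff.1 (Set.countable_univ_iff.1 h1)

/-- The disjoint sets `E Q` have positive measure. Countability is what lets the measure pass to the
limit along finite subfamilies. -/
theorem IsSparse.countable {S : Set (Cube n)} (hS : IsSparse S) : S.Countable := by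
  obtain ⟨E, hE, hd⟩ := hS
  have h1 := Measure.countable_meas_pos_of_disjoint_iUnion (μ := (volume : Measure (Fin n → ℝ)))
    (As := fun Q : S => E Q) (fun Q => (hE Q Q.2).1)
    (fun P Q hPQ => hd P.2 Q.2 (fun e => hPQ (Subtype.ext e)))
  have h2 : {i : S | 0 < volume (E i)} = Set.univ := by
    ext Q
    simp only [Set.mem_ofPred_eq, Set.mem_univ, iff_true]
    refine pos_iff_ne_zero.2 fun h0 => Q.1.volume_ne_zero ?_
    simpa [h0] using (hE Q Q.2).2.2
  rw [h2] at h1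
  exact Set.countable_coe_iff.1 (Set.countable_univ_iff.1 h1)

/-! ### Dyadic grids: maximal cubes, parents, differentiation, superlevel sets -/

namespace IsDyadicGrid

variable {D : Set (Cube n)}

theorem eq_of_side_eq (hD : IsDyadicGrid D) {P Q : Cube n} (hP : P ∈ D) (hQ : Q ∈ D)
    (hs : P.side = Q.side) {x : Fin n → ℝ} (hxP : x ∈ P.toSet) (hxQ : x ∈ Q.toSet) : P = Q := by
  obtain ⟨k, hk⟩ := hD.side_eq P hP
  exact (hD.partition k x).unique ⟨hP, hk, hxP⟩ ⟨hQ, hs ▸ hk, hxQ⟩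

theorem subset_of_side_le (hn : n ≠ 0) (hD : IsDyadicGrid D) {P Q : Cube n} (hP : P ∈ D)
    (hQ : Q ∈ D) (hs : P.side ≤ Q.side) {x : Fin n → ℝ} (hxP : x ∈ P.toSet) (hxQ : x ∈ Q.toSet) :
    P.toSet ⊆ Q.toSet := by
  rcases hD.nested P hP Q hQ with h | h | h
  · exact absurd (Set.mem_inter hxP hxQ) (by simp [h])
  · exact h
  · rw [hD.eq_of_side_eq hP hQ (le_antisymm hs (Cube.side_le_of_subset hn h)) hxP hxQ]

theorem eq_of_subset_of_side_le (hn : n ≠ 0) (hD : IsDyadicGrid D) {P Q : Cube n} (hP : P ∈ D)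
    (hQ : Q ∈ D) (h : P.toSet ⊆ Q.toSet) (hs : Q.side ≤ P.side) : P = Q :=
  hD.eq_of_side_eq hP hQ (le_antisymm (Cube.side_le_of_subset hn h) hs) P.corner_mem
    (h P.corner_mem)

/-- The maximal cubes of a family of dyadic cubes of bounded side length. -/
theorem exists_maximal (hn : n ≠ 0) (hD : IsDyadicGrid D) {T : Set (Cube n)} (hT : T ⊆ D)
    {B : ℝ} (hB : ∀ P ∈ T, P.side ≤ B) :
    ∃ T' ⊆ T, T'.PairwiseDisjoint Cube.toSet ∧ T'.Countable ∧
      (∀ P ∈ T, ∃ R ∈ T', P.toSet ⊆ R.toSet) ∧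
      ∀ P ∈ T', ∀ R ∈ T, P.toSet ⊆ R.toSet → R = P := by
  have hdisj : {P ∈ T | ∀ R ∈ T, P.toSet ⊆ R.toSet → R = P}.PairwiseDisjoint Cube.toSet := by
    rintro P ⟨hP, hPm⟩ Q ⟨hQ, hQm⟩ hne
    rcases hD.nested P (hT hP) Q (hT hQ) with h | h | h
    · exact Set.disjoint_iff_inter_eq_empty.2 h
    · exact absurd (hPm Q hQ h).symm hne
    · exact absurd (hQm P hP h) hne
  refine ⟨{P ∈ T | ∀ R ∈ T, P.toSet ⊆ R.toSet → R = P}, fun P hP => hP.1, hdisj,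
    countable_of_pairwiseDisjoint_toSet hdisj, fun P hP => ?_, fun P hP => hP.2⟩
  -- The side lengths are bounded powers of two, so among the cubes of `T` containing `P` one has
  -- the largest side; that cube is maximal.
  obtain ⟨b, hb⟩ := pow_unbounded_of_one_lt B (one_lt_two (α := ℝ))
  obtain ⟨k, ⟨R, hR, hPR, hRk⟩, hmax⟩ := Int.exists_greatest_of_bdd
    (P := fun k : ℤ => ∃ R ∈ T, P.toSet ⊆ R.toSet ∧ R.side = (2 : ℝ) ^ k)
    ⟨b, by
      rintro z ⟨R, hR, -, hz⟩
      have h1 : (2 : ℝ) ^ z < (2 : ℝ) ^ (b : ℤ) := by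
        rw [← hz, zpow_natCast]; exact (hB R hR).trans_lt hb
      exact ((zpow_lt_zpow_iff_right₀ one_lt_two).1 h1).le⟩
    (by
      obtain ⟨k, hk⟩ := hD.side_eq P (hT hP)
      exact ⟨k, P, hP, subset_rfl, hk⟩)
  refine ⟨R, ⟨hR, fun R' hR' hRR' => ?_⟩, hPR⟩
  obtain ⟨k', hk'⟩ := hD.side_eq R' (hT hR')
  refine (hD.eq_of_subset_of_side_le hn (hT hR) (hT hR') hRR' ?_).symm
  rw [hk', hRk]
  exact zpow_le_zpow_right₀ one_le_two (hmax k' ⟨R', hR', hPR.trans hRR', hk'⟩)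

/-- The parent is the cube of twice the side containing the corner of `P`. It is minimal because a
strictly larger power of two is at least the double. -/
theorem exists_parent (hn : n ≠ 0) (hD : IsDyadicGrid D) {P : Cube n} (hP : P ∈ D) :
    ∃ R ∈ D, P.toSet ⊆ R.toSet ∧ R ≠ P ∧ volume R.toSet = 2 ^ n * volume P.toSet ∧
      ∀ Q ∈ D, P.toSet ⊆ Q.toSet → Q ≠ P → R.toSet ⊆ Q.toSet := by
  obtain ⟨k, hk⟩ := hD.side_eq P hP
  obtain ⟨R, ⟨hR, hRk, hxR⟩, -⟩ := hD.partition (k + 1) P.corner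
  have h2 : R.side = 2 * P.side := by rw [hRk, hk, zpow_add_one₀ two_ne_zero, mul_comm]
  refine ⟨R, hR, hD.subset_of_side_le hn hP hR (by linarith [P.side_pos]) P.corner_mem hxR,
    ?_, ?_, ?_⟩
  · rintro rfl; linarith [R.side_pos]
  · rw [R.volume_eq, P.volume_eq, h2, ENNReal.ofReal_mul zero_le_two, mul_pow]; simp
  · intro Q hQ hPQ hne
    refine hD.subset_of_side_le hn hR hQ ?_ hxR (hPQ P.corner_mem)
    obtain ⟨j, hj⟩ := hD.side_eq Q hQ
    have hlt : P.side < Q.side := by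
      by_contra hle
      exact hne (hD.eq_of_subset_of_side_le hn hP hQ hPQ (not_lt.1 hle)).symm
    rw [hj, hk] at hlt
    rw [hj, hRk]
    exact zpow_le_zpow_right₀ one_le_two
      (Int.add_one_le_of_lt ((zpow_lt_zpow_iff_right₀ one_lt_two).1 hlt))

/-- Lebesgue differentiation along the cubes of a dyadic grid. -/
theorem ae_exists_lt_lintegral (hn : n ≠ 0) (hD : IsDyadicGrid D) {Q : Cube n} (hQ : Q ∈ D)
    {u : (Fin n → ℝ) → ℝ≥0∞} (hu : Measurable u) (hfin : ∫⁻ x in Q.toSet, u x ≠ ∞) :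
    ∀ᵐ x ∂(volume : Measure (Fin n → ℝ)), x ∈ Q.toSet → ∀ c < u x,
      ∃ R ∈ D, R.toSet ⊆ Q.toSet ∧ x ∈ R.toSet ∧ c * volume R.toSet < ∫⁻ y in R.toSet, u y := by
  have key := VitaliFamily.ae_tendsto_lintegral_div
    (IsUnifLocDoublingMeasure.vitaliFamily (volume : Measure (Fin n → ℝ)) 1)
    (f := Q.toSet.indicator u) (hu.indicator Q.measurableSet).aemeasurable
    (by rwa [lintegral_indicator Q.measurableSet])
  filter_upwards [key] with x hx hxQ c hc
  -- The cubes of side `2 ^ (-i)` around `x` are, up to null sets, closed sup-norm balls containing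
  -- `x`, so differentiation along a Vitali family of balls applies.
  choose R hR using fun i : ℕ => (hD.partition (-(i : ℤ)) x).exists
  set ctr : ℕ → Fin n → ℝ := fun i j => (R i).corner j + (R i).side / 2
  have hball : ∀ i, Metric.closedBall (ctr i) ((R i).side / 2)
      = Set.Icc (R i).corner (fun j => (R i).corner j + (R i).side) := by
    intro i
    rw [closedBall_pi _ (by linarith [(R i).side_pos]), ← Set.pi_univ_Icc]
    congr 1
    ext j y
    rw [Real.closedBall_eq_Icc]
    simp only [ctr, Set.mem_Icc]
    constructor <;> rintro ⟨h1, h2⟩ <;> constructor <;> linarith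
  have hae : ∀ i, Metric.closedBall (ctr i) ((R i).side / 2) =ᵐ[volume] (R i).toSet := by
    intro i
    rw [hball, (R i).toSet_eq_pi]
    exact Measure.univ_pi_Ico_ae_eq_Icc.symm
  have hside : ∀ i, (R i).side = (1 / 2 : ℝ) ^ i := by
    intro i; rw [(hR i).2.1, zpow_neg, zpow_natCast]; simp
  have hlim : Filter.Tendsto (fun i => (R i).side) Filter.atTop (nhds 0) := by
    simp only [hside]
    exact tendsto_pow_atTop_nhds_zero_of_lt_one (by norm_num) (by norm_num)
  have ht := IsUnifLocDoublingMeasure.tendsto_closedBall_filterAt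
    (volume : Measure (Fin n → ℝ)) (K := 1) (x := x) ctr (fun i => (R i).side / 2)
    (l := Filter.atTop)
    (tendsto_nhdsWithin_iff.2 ⟨by simpa using hlim.div_const 2,
      Filter.Eventually.of_forall fun i => half_pos (R i).side_pos⟩)
    (Filter.Eventually.of_forall fun i => by
      rw [one_mul, hball]
      exact ⟨fun j => ((hR i).2.2 j).1, fun j => ((hR i).2.2 j).2.le⟩)
  have h1 := (hx.comp ht).eventually_const_lt
    (show c < Q.toSet.indicator u x by rwa [Set.indicator_of_mem hxQ])
  have h2 : ∀ᶠ i in Filter.atTop, (R i).side < Q.side :=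
    hlim.eventually_lt_const Q.side_pos
  obtain ⟨i, hi1, hi2⟩ := (h1.and h2).exists
  have hsub : (R i).toSet ⊆ Q.toSet :=
    hD.subset_of_side_le hn (hR i).1 hQ hi2.le (hR i).2.2 hxQ
  refine ⟨R i, (hR i).1, hsub, (hR i).2.2, ?_⟩
  simp only [Function.comp] at hi1
  rw [measure_congr (hae i), Measure.restrict_congr_set (hae i),
    setLIntegral_indicator Q.measurableSet, Set.inter_eq_right.2 hsub] at hi1
  exact (ENNReal.lt_div_iff_mul_lt (Or.inl (R i).volume_ne_zero)
    (Or.inl (R i).volume_ne_top)).1 hi1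

end IsDyadicGrid

/-- The part of `Q` covered by the dyadic subcubes of `Q` on which `u` has average above `s`. -/
def superlevel (D : Set (Cube n)) (Q : Cube n) (u : (Fin n → ℝ) → ℝ≥0∞) (s : ℝ≥0∞) :
    Set (Fin n → ℝ) :=
  {x | ∃ R ∈ D, R.toSet ⊆ Q.toSet ∧ x ∈ R.toSet ∧ s * volume R.toSet < ∫⁻ y in R.toSet, u y}

theorem superlevel_subset (D : Set (Cube n)) (Q : Cube n) (u : (Fin n → ℝ) → ℝ≥0∞) (s : ℝ≥0∞) :
    superlevel D Q u s ⊆ Q.toSet := by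
  rintro x ⟨R, -, hRQ, hx, -⟩
  exact hRQ hx

theorem superlevel_anti (D : Set (Cube n)) (Q : Cube n) (u : (Fin n → ℝ) → ℝ≥0∞)
    {s t : ℝ≥0∞} (h : s ≤ t) : superlevel D Q u t ⊆ superlevel D Q u s := by
  rintro x ⟨R, hR, hRQ, hx, hlt⟩
  exact ⟨R, hR, hRQ, hx, (mul_le_mul_left h _).trans_lt hlt⟩

/-- The admitted terms form a geometric sum, at most twice its last term, which is at most `M`. -/
theorem sum_geometric_indicator_le (t M : ℝ≥0∞) (J : ℕ) :
    ∑ j ∈ Finset.range J, (if 2 ^ j * t ≤ M then 2 ^ j * t else 0) ≤ 2 * M := by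
  have hgeo : ∀ J : ℕ, ∑ j ∈ Finset.range J, (if 2 ^ j * t ≤ M then 2 ^ j * t else 0)
      ≤ 2 ^ J * t := by
    intro J
    induction J with
    | zero => simp
    | succ J ih =>
      rw [Finset.sum_range_succ, pow_succ, mul_two, add_mul]
      gcongr
      split_ifs <;> simp
  induction J with
  | zero => simp
  | succ J ih =>
    by_cases h : 2 ^ J * t ≤ M
    · refine (hgeo (J + 1)).trans ?_
      rw [pow_succ, mul_comm (2 ^ J) 2, mul_assoc]
      gcongr
    · rw [Finset.sum_range_succ, if_neg h, add_zero]
      exact ih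

/-! ### Decay of the level sets of an `A_∞` weight -/

namespace IsDyadicGrid

variable {D : Set (Cube n)}

/-- The stopping cubes: maximal dyadic subcubes of `Q` on which the average exceeds `s`. -/
theorem exists_superlevel_eq (hn : n ≠ 0) (hD : IsDyadicGrid D) (Q : Cube n)
    (u : (Fin n → ℝ) → ℝ≥0∞) (s : ℝ≥0∞) :
    ∃ T ⊆ D, T.PairwiseDisjoint Cube.toSet ∧ T.Countable ∧
      superlevel D Q u s = ⋃ P ∈ T, P.toSet ∧
      ∀ P ∈ T, P.toSet ⊆ Q.toSet ∧ s * volume P.toSet < ∫⁻ y in P.toSet, u y ∧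
        ∀ R ∈ D, R.toSet ⊆ Q.toSet → s * volume R.toSet < ∫⁻ y in R.toSet, u y →
          P.toSet ⊆ R.toSet → R = P := by
  obtain ⟨T, hT, hdisj, hcount, hcov, hmax⟩ := hD.exists_maximal hn
    (T := {R | R ∈ D ∧ R.toSet ⊆ Q.toSet ∧ s * volume R.toSet < ∫⁻ y in R.toSet, u y})
    (fun R hR => hR.1) (B := Q.side) (fun R hR => Cube.side_le_of_subset hn hR.2.1)
  refine ⟨T, fun P hP => (hT hP).1, hdisj, hcount, ?_, fun P hP =>
    ⟨(hT hP).2.1, (hT hP).2.2, fun R hR hRQ hRs hPR => hmax P hP R ⟨hR, hRQ, hRs⟩ hPR⟩⟩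
  ext x
  simp only [Set.mem_iUnion]
  constructor
  · rintro ⟨R, hR, hRQ, hx, hlt⟩
    obtain ⟨P, hP, hRP⟩ := hcov R ⟨hR, hRQ, hlt⟩
    exact ⟨P, hP, hRP hx⟩
  · rintro ⟨P, hP, hx⟩
    exact ⟨P, (hT hP).1, (hT hP).2.1, hx, (hT hP).2.2⟩

theorem measurableSet_superlevel (hn : n ≠ 0) (hD : IsDyadicGrid D) (Q : Cube n)
    (u : (Fin n → ℝ) → ℝ≥0∞) (s : ℝ≥0∞) : MeasurableSet (superlevel D Q u s) := by
  obtain ⟨T, -, -, hc, h, -⟩ := hD.exists_superlevel_eq hn Q u s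
  rw [h]
  exact MeasurableSet.biUnion hc fun P _ => P.measurableSet

/-- The parent of a stopping cube was not selected, so its average is at most `s`; passing to it
costs the volume ratio `2 ^ n`. -/
theorem lintegral_superlevel_le (hn : n ≠ 0) (hD : IsDyadicGrid D) {Q : Cube n} (hQ : Q ∈ D)
    {u : (Fin n → ℝ) → ℝ≥0∞} {s : ℝ≥0∞} (hs : ∫⁻ x in Q.toSet, u x ≤ s * volume Q.toSet) :
    ∫⁻ x in superlevel D Q u s, u x ≤ 2 ^ n * (s * volume (superlevel D Q u s)) := by
  obtain ⟨T, hTD, hd, hc, h, hm⟩ := hD.exists_superlevel_eq hn Q u s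
  rw [h, lintegral_biUnion hc (fun P _ => P.measurableSet) hd,
    measure_biUnion hc hd (fun P _ => P.measurableSet), ← ENNReal.tsum_mul_left,
    ← ENNReal.tsum_mul_left]
  refine ENNReal.tsum_le_tsum fun P => ?_
  obtain ⟨hPQ, hPs, hPm⟩ := hm P P.2
  obtain ⟨R, hR, hPR, hne, hvol, hmin⟩ := hD.exists_parent hn (hTD P.2)
  -- `Q` itself is not selected, so the parent of `P` still lies in `Q` and competes in the
  -- maximality of `P`.
  have hQP : Q ≠ P := by
    rintro e
    rw [← e] at hPs
    exact absurd hs (not_le.2 hPs)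
  have hRQ := hmin Q hQ hPQ hQP
  have hle : ∫⁻ y in R.toSet, u y ≤ s * volume R.toSet := by
    by_contra hlt
    exact hne (hPm R hR hRQ (not_le.1 hlt) hPR)
  calc ∫⁻ x in (P : Cube n).toSet, u x ≤ ∫⁻ x in R.toSet, u x := lintegral_mono_set hPR
    _ ≤ s * volume R.toSet := hle
    _ = 2 ^ n * (s * volume (P : Cube n).toSet) := by rw [hvol]; ring

/-- On a stopping cube `P` of height `s`, a point in the superlevel set of height `2 ^ j * s` has
maximal function of `u χ_P` at least that height. Summed over `j`, the heights are at most twice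
this maximal function, and the `A_∞` condition on `P` bounds its integral. -/
theorem sum_volume_superlevel_le (hn : n ≠ 0) (hD : IsDyadicGrid D) (Q : Cube n)
    {u : (Fin n → ℝ) → ℝ≥0∞} {A : ℝ≥0∞}
    (hA : ∀ P : Cube n, ∫⁻ x in P.toSet, (⨆ R : Cube n, R.toSet.indicator
      (fun _ => ⨍⁻ y in R.toSet, P.toSet.indicator u y ∂volume) x) ≤ A * ∫⁻ x in P.toSet, u x)
    (s : ℝ≥0∞) (N : ℕ) :
    ∑ j ∈ Finset.range N, 2 ^ j * s * volume (superlevel D Q u (2 ^ j * s)) ≤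
      2 * A * ∫⁻ x in superlevel D Q u s, u x := by
  obtain ⟨T, hTD, hd, hc, h, hm⟩ := hD.exists_superlevel_eq hn Q u s
  have hsub : ∀ j : ℕ, superlevel D Q u (2 ^ j * s) ⊆ superlevel D Q u s := fun j =>
    superlevel_anti D Q u (le_mul_of_one_le_left' (one_le_pow₀ one_le_two))
  have hmeas : ∀ j : ℕ, MeasurableSet (superlevel D Q u (2 ^ j * s)) := fun j =>
    hD.measurableSet_superlevel hn Q u _
  have hvol : ∀ j : ℕ, volume (superlevel D Q u (2 ^ j * s)) ≤
      ∑' P : T, volume (superlevel D Q u (2 ^ j * s) ∩ (P : Cube n).toSet) := by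
    intro j
    have : superlevel D Q u (2 ^ j * s) ⊆
        ⋃ P ∈ T, superlevel D Q u (2 ^ j * s) ∩ P.toSet := by
      rw [← Set.inter_iUnion₂, ← h]
      exact Set.subset_inter subset_rfl (hsub j)
    exact (measure_mono this).trans (measure_biUnion_le volume hc _)
  calc ∑ j ∈ Finset.range N, 2 ^ j * s * volume (superlevel D Q u (2 ^ j * s))
      ≤ ∑ j ∈ Finset.range N,
          ∑' P : T, 2 ^ j * s * volume (superlevel D Q u (2 ^ j * s) ∩ (P : Cube n).toSet) := by
        refine Finset.sum_le_sum fun j _ => ?_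
        rw [ENNReal.tsum_mul_left]
        exact mul_le_mul_right (hvol j) _
    _ = ∑' P : T, ∑ j ∈ Finset.range N,
          2 ^ j * s * volume (superlevel D Q u (2 ^ j * s) ∩ (P : Cube n).toSet) :=
        (Summable.tsum_finsetSum fun _ _ => ENNReal.summable).symm
    _ ≤ ∑' P : T, 2 * A * ∫⁻ x in (P : Cube n).toSet, u x := by
        refine ENNReal.tsum_le_tsum fun P => ?_
        obtain ⟨hPQ, hPs, hPm⟩ := hm P P.2
        rw [mul_assoc]
        refine le_trans ?_ (mul_le_mul_right (hA P) _)
        rw [← lintegral_const_mul' _ _ ENNReal.ofNat_ne_top]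
        calc ∑ j ∈ Finset.range N,
              2 ^ j * s * volume (superlevel D Q u (2 ^ j * s) ∩ (P : Cube n).toSet)
            = ∑ j ∈ Finset.range N, ∫⁻ x in (P : Cube n).toSet,
                (superlevel D Q u (2 ^ j * s)).indicator (fun _ => 2 ^ j * s) x := by
              refine Finset.sum_congr rfl fun j _ => ?_
              rw [lintegral_indicator_const (hmeas j), Measure.restrict_apply (hmeas j)]
          _ = ∫⁻ x in (P : Cube n).toSet, ∑ j ∈ Finset.range N,
                (superlevel D Q u (2 ^ j * s)).indicator (fun _ => 2 ^ j * s) x :=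
              (lintegral_finsetSum _ fun j _ => measurable_const.indicator (hmeas j)).symm
          _ ≤ _ := by
              refine setLIntegral_mono' P.1.measurableSet fun x hx => ?_
              refine le_trans (Finset.sum_le_sum fun j _ => ?_)
                (sum_geometric_indicator_le s _ N)
              by_cases hxj : x ∈ superlevel D Q u (2 ^ j * s)
              · rw [Set.indicator_of_mem hxj, if_pos]
                obtain ⟨R, hR, hRQ, hxR, hlt⟩ := hxj
                have hlt' : s * volume R.toSet < ∫⁻ y in R.toSet, u y :=
                  (mul_le_mul_left (le_mul_of_one_le_left' (one_le_pow₀ one_le_two)) _).trans_lt hlt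
                -- A selected cube meeting `P` cannot be strictly larger, by maximality of `P`;
                -- hence localizing `u` to `P` does not change its average.
                have hRP : R.toSet ⊆ (P : Cube n).toSet := by
                  rcases hD.nested R hR P (hTD P.2) with h0 | h0 | h0
                  · exact absurd (Set.mem_inter hxR hx) (by simp [h0])
                  · exact h0
                  · rw [hPm R hR hRQ hlt' h0]
                refine le_trans ?_ (le_iSup _ R)
                rw [Set.indicator_of_mem hxR, setLAverage_eq,
                  setLIntegral_indicator P.1.measurableSet, Set.inter_eq_right.2 hRP]
                exact (ENNReal.le_div_iff_mul_le (Or.inl R.volume_ne_zero)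
                  (Or.inl R.volume_ne_top)).2 hlt.le
              · rw [Set.indicator_of_notMem hxj]
                exact zero_le
    _ = 2 * A * ∫⁻ x in superlevel D Q u s, u x := by
        rw [h, lintegral_biUnion hc (fun P _ => P.measurableSet) hd, ENNReal.tsum_mul_left]

section Decay

variable {u : (Fin n → ℝ) → ℝ≥0∞} {A : ℝ≥0∞} {Q : Cube n} {N : ℕ}

/-- Each of the `N` heights `2 ^ j * s`, `j < N`, contributes at least `2 ^ (-n)` times the mass
above `2 ^ N * s` to the preceding sum. Taking `N ≥ 2 ^ (n + 2) * A` therefore halves the mass in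
`N` doublings. -/
theorem two_mul_lintegral_superlevel_le (hn : n ≠ 0) (hD : IsDyadicGrid D)
    (hA : ∀ P : Cube n, ∫⁻ x in P.toSet, (⨆ R : Cube n, R.toSet.indicator
      (fun _ => ⨍⁻ y in R.toSet, P.toSet.indicator u y ∂volume) x) ≤ A * ∫⁻ x in P.toSet, u x)
    (hQ : Q ∈ D) (hN : N ≠ 0) (hAN : 2 ^ (n + 2) * A ≤ N)
    {s : ℝ≥0∞} (hQs : ∫⁻ x in Q.toSet, u x ≤ s * volume Q.toSet) :
    2 * ∫⁻ x in superlevel D Q u (2 ^ N * s), u x ≤ ∫⁻ x in superlevel D Q u s, u x := by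
  have h1 : (N : ℝ≥0∞) * ∫⁻ x in superlevel D Q u (2 ^ N * s), u x ≤
      2 ^ n * (2 * A * ∫⁻ x in superlevel D Q u s, u x) := by
    refine le_trans ?_ (mul_le_mul_right (hD.sum_volume_superlevel_le hn Q hA s N) _)
    rw [Finset.mul_sum]
    calc (N : ℝ≥0∞) * ∫⁻ x in superlevel D Q u (2 ^ N * s), u x
        = ∑ j ∈ Finset.range N, ∫⁻ x in superlevel D Q u (2 ^ N * s), u x := by simp
      _ ≤ _ := by
        refine Finset.sum_le_sum fun j hj => ?_
        refine (lintegral_mono_set (superlevel_anti D Q u (?_ : 2 ^ j * s ≤ 2 ^ N * s))).trans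
          (hD.lintegral_superlevel_le hn hQ ?_)
        · gcongr
          · exact one_le_two
          · exact (Finset.mem_range.1 hj).le
        · refine hQs.trans (mul_le_mul_left ?_ _)
          exact le_mul_of_one_le_left' (one_le_pow₀ one_le_two)
  have hN0 : (N : ℝ≥0∞) ≠ 0 := by exact_mod_cast hN
  refine (ENNReal.mul_le_mul_iff_right hN0 (ENNReal.natCast_ne_top N)).1 ?_
  calc (N : ℝ≥0∞) * (2 * ∫⁻ x in superlevel D Q u (2 ^ N * s), u x)
      = 2 * (N * ∫⁻ x in superlevel D Q u (2 ^ N * s), u x) := by ring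
    _ ≤ 2 * (2 ^ n * (2 * A * ∫⁻ x in superlevel D Q u s, u x)) := by gcongr
    _ = 2 ^ (n + 2) * A * ∫⁻ x in superlevel D Q u s, u x := by ring
    _ ≤ _ := by gcongr

theorem two_pow_mul_lintegral_superlevel_le (hn : n ≠ 0) (hD : IsDyadicGrid D)
    (hA : ∀ P : Cube n, ∫⁻ x in P.toSet, (⨆ R : Cube n, R.toSet.indicator
      (fun _ => ⨍⁻ y in R.toSet, P.toSet.indicator u y ∂volume) x) ≤ A * ∫⁻ x in P.toSet, u x)
    (hQ : Q ∈ D) (hN : N ≠ 0) (hAN : 2 ^ (n + 2) * A ≤ N)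
    {s : ℝ≥0∞} (hQs : ∫⁻ x in Q.toSet, u x ≤ s * volume Q.toSet) (i : ℕ) :
    2 ^ i * ∫⁻ x in superlevel D Q u (2 ^ (N * i) * s), u x ≤ ∫⁻ x in Q.toSet, u x := by
  induction i with
  | zero => simpa using lintegral_mono_set (superlevel_subset D Q u s)
  | succ i ih =>
    have h := hD.two_mul_lintegral_superlevel_le hn hA hQ hN hAN (s := 2 ^ (N * i) * s)
      (hQs.trans (mul_le_mul_left (le_mul_of_one_le_left' (one_le_pow₀ one_le_two)) _))
    refine le_trans ?_ ih
    rw [pow_succ, mul_assoc, mul_add_one N i, pow_add, mul_comm (2 ^ (N * i)) (2 ^ N), mul_assoc]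
    gcongr

/-- The sharp reverse Hölder inequality of an `A_∞` weight, as a decay estimate for its level
sets on a dyadic cube. -/
theorem volume_level_le (hn : n ≠ 0) (hD : IsDyadicGrid D) (hu : Measurable u)
    (hA : ∀ P : Cube n, ∫⁻ x in P.toSet, (⨆ R : Cube n, R.toSet.indicator
      (fun _ => ⨍⁻ y in R.toSet, P.toSet.indicator u y ∂volume) x) ≤ A * ∫⁻ x in P.toSet, u x)
    (hQ : Q ∈ D) (hN : N ≠ 0) (hAN : 2 ^ (n + 2) * A ≤ N)
    (hfin : ∫⁻ x in Q.toSet, u x ≠ ∞) (hpos : ∫⁻ x in Q.toSet, u x ≠ 0) (k : ℕ) :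
    (2 * 2 ^ (1 / N : ℝ)) ^ k *
        volume (Q.toSet ∩ {x | 2 ^ k * (⨍⁻ y in Q.toSet, u y ∂volume) < u x}) ≤ 2 * volume Q.toSet := by
  set t := ⨍⁻ y in Q.toSet, u y ∂volume with ht
  have htQ : t * volume Q.toSet = ∫⁻ x in Q.toSet, u x := by
    rw [ht, setLAverage_eq, ENNReal.div_mul_cancel Q.volume_ne_zero Q.volume_ne_top]
  have ht_top : t ≠ ∞ := by
    rw [ht, setLAverage_eq]; exact (ENNReal.div_lt_top hfin Q.volume_ne_zero).ne
  have ht0 : t ≠ 0 := fun h => hpos (by rw [← htQ, h, zero_mul])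
  set L := Q.toSet ∩ {x | 2 ^ k * t < u x} with hL
  -- By Lebesgue differentiation, almost every point of `L` lies in a dyadic subcube whose average
  -- exceeds the same height.
  have hLsub : volume L ≤ volume (L ∩ superlevel D Q u (2 ^ k * t)) := by
    refine measure_mono_ae ?_
    filter_upwards [hD.ae_exists_lt_lintegral hn hQ hu hfin] with x hx hxL
    exact ⟨hxL, hx hxL.1 _ hxL.2⟩
  have h1 : 2 ^ k * t * volume L ≤ ∫⁻ x in superlevel D Q u (2 ^ k * t), u x := by
    calc 2 ^ k * t * volume L
        ≤ 2 ^ k * t * volume (L ∩ superlevel D Q u (2 ^ k * t)) := by gcongr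
      _ = ∫⁻ x in L ∩ superlevel D Q u (2 ^ k * t), 2 ^ k * t := by rw [setLIntegral_const]
      _ ≤ ∫⁻ x in L ∩ superlevel D Q u (2 ^ k * t), u x :=
        setLIntegral_mono hu fun x hx => le_of_lt hx.1.2
      _ ≤ _ := lintegral_mono_set Set.inter_subset_right
  have h2 : ∫⁻ x in superlevel D Q u (2 ^ k * t), u x ≤
      ∫⁻ x in superlevel D Q u (2 ^ (N * (k / N)) * t), u x := by
    refine lintegral_mono_set (superlevel_anti D Q u ?_)
    gcongr
    · exact one_le_two
    · exact Nat.mul_div_le k N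
  have h3 := hD.two_pow_mul_lintegral_superlevel_le hn hA hQ hN hAN htQ.ge (k / N)
  have h4 : 2 ^ (k / N) * (2 ^ k * volume L) ≤ volume Q.toSet := by
    refine (ENNReal.mul_le_mul_iff_right ht0 ht_top).1 ?_
    rw [htQ]
    refine le_trans ?_ h3
    calc t * (2 ^ (k / N) * (2 ^ k * volume L)) = 2 ^ (k / N) * (2 ^ k * t * volume L) := by ring
      _ ≤ _ := by gcongr; exact h1.trans h2
  -- The exponent on the right is a floor; rounding it is the source of the factor `2` in the
  -- conclusion.
  have h5 : ((2 : ℝ≥0∞) ^ (1 / N : ℝ)) ^ k ≤ 2 * 2 ^ (k / N) := by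
    rw [← ENNReal.rpow_natCast, ← ENNReal.rpow_mul, ← pow_succ', ← ENNReal.rpow_natCast]
    refine ENNReal.rpow_le_rpow_of_exponent_le one_le_two ?_
    have hNpos : (0 : ℝ) < N := by exact_mod_cast Nat.pos_of_ne_zero hN
    rw [one_div, inv_mul_le_iff₀ hNpos]
    have := Nat.lt_mul_div_succ k (Nat.pos_of_ne_zero hN)
    exact_mod_cast this.le
  calc (2 * 2 ^ (1 / N : ℝ)) ^ k * volume L
      = (2 ^ (1 / N : ℝ)) ^ k * (2 ^ k * volume L) := by rw [mul_pow]; ring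
    _ ≤ 2 * 2 ^ (k / N) * (2 ^ k * volume L) := by gcongr
    _ = 2 * (2 ^ (k / N) * (2 ^ k * volume L)) := by ring
    _ ≤ _ := by gcongr

end Decay

end IsDyadicGrid

/-! ### Layer cake and geometric sums -/

theorem le_add_tsum_layers {s ρ : ℝ≥0∞} (hs : s ≠ 0) (hρ : 1 < ρ) (y : ℝ≥0∞) :
    y ≤ s + ∑' i : ℕ, if ρ ^ i * s < y then ρ ^ (i + 1) * s else 0 := by
  have hmin : ∀ J : ℕ, min y (ρ ^ J * s) ≤
      s + ∑ i ∈ Finset.range J, if ρ ^ i * s < y then ρ ^ (i + 1) * s else 0 := by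
    intro J
    induction J with
    | zero => simp
    | succ J ih =>
      rw [Finset.sum_range_succ]
      by_cases h : ρ ^ J * s < y
      · rw [if_pos h]
        exact (min_le_right _ _).trans (le_add_left le_add_self)
      · rw [if_neg h, add_zero]
        refine le_trans ?_ ih
        rw [min_eq_left (not_lt.1 h)]
        exact min_le_left _ _
  have hlim : Filter.Tendsto (fun J : ℕ => min y (ρ ^ J * s)) Filter.atTop (nhds y) := by
    have h1 : Filter.Tendsto (fun J : ℕ => ρ ^ J * s) Filter.atTop (nhds ∞) := by
      have := ENNReal.Tendsto.mul_const
        (ENNReal.tendsto_pow_atTop_nhds_top_iff.2 hρ) (b := s) (Or.inl ENNReal.top_ne_zero)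
      rwa [ENNReal.top_mul hs] at this
    simpa using (tendsto_const_nhds (x := y)).min h1
  exact le_of_tendsto' hlim fun J => (hmin J).trans (by gcongr; exact ENNReal.sum_le_tsum _)

/-- The layer cake estimate along a geometric sequence of heights. -/
theorem lintegral_le_of_layers {X : Type*} [MeasurableSpace X] (μ : Measure X) {g : X → ℝ≥0∞}
    (hg : Measurable g) {s V ρ τ : ℝ≥0∞} (hs : s ≠ 0) (hρ : 1 < ρ) (hV : μ Set.univ ≤ V)
    (hl : ∀ i : ℕ, μ {x | ρ ^ i * s < g x} ≤ 2 * τ ^ i * V) :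
    ∫⁻ x, g x ∂μ ≤ s * V * (1 + 2 * ρ * (1 - ρ * τ)⁻¹) := by
  have hm : ∀ i : ℕ, MeasurableSet {x | ρ ^ i * s < g x} := fun i =>
    measurableSet_lt measurable_const hg
  calc ∫⁻ x, g x ∂μ
      ≤ ∫⁻ x, (s + ∑' i : ℕ, {x | ρ ^ i * s < g x}.indicator (fun _ => ρ ^ (i + 1) * s) x) ∂μ := by
        refine lintegral_mono fun x => ?_
        refine (le_add_tsum_layers hs hρ (g x)).trans_eq ?_
        simp [Set.indicator_apply]
    _ = s * μ Set.univ + ∑' i : ℕ, ρ ^ (i + 1) * s * μ {x | ρ ^ i * s < g x} := by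
        rw [lintegral_add_left measurable_const, lintegral_const,
          lintegral_tsum fun i => (measurable_const.indicator (hm i)).aemeasurable]
        simp only [lintegral_indicator_const (hm _)]
    _ ≤ s * V + ∑' i : ℕ, ρ ^ (i + 1) * s * (2 * τ ^ i * V) := by
        gcongr with i
        exact hl i
    _ = s * V + ∑' i : ℕ, s * V * (2 * ρ) * (ρ * τ) ^ i := by
        congr 2
        ext i
        rw [mul_pow]; ring
    _ = _ := by
        rw [ENNReal.tsum_mul_left, ENNReal.tsum_geometric]; ring

/-- Bernoulli gives `(1 - 1/(2M)) ^ M ≥ 1/2`, so the ratio is at most `1 - 1/(2M)`. This is the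
source of the linear dependence on the `A_∞` characteristic. -/
theorem tsum_dyadic_root_le {M : ℝ} (hM : 1 ≤ M) :
    ∑' m : ℕ, ((2 : ℝ≥0∞)⁻¹ ^ (1 / M)) ^ m ≤ ENNReal.ofReal (2 * M) := by
  have hM0 : 0 < M := by linarith
  have hr : (2⁻¹ : ℝ) ^ (1 / M) ≤ 1 - (2 * M)⁻¹ := by
    have hx : (2 * M)⁻¹ ≤ 1 / 2 := by
      rw [inv_le_comm₀ (by positivity) (by norm_num)]; linarith
    have h1 := one_add_mul_self_le_rpow_one_add (s := -(2 * M)⁻¹) (by linarith) hM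
    have h2 : (2⁻¹ : ℝ) ≤ (1 - (2 * M)⁻¹) ^ M := by
      refine le_trans (le_of_eq ?_) (h1.trans_eq (by ring_nf))
      field_simp; norm_num
    calc (2⁻¹ : ℝ) ^ (1 / M) ≤ ((1 - (2 * M)⁻¹) ^ M) ^ (1 / M) :=
          Real.rpow_le_rpow (by norm_num) h2 (by positivity)
      _ = 1 - (2 * M)⁻¹ := by
          rw [← Real.rpow_mul (by linarith), mul_one_div_cancel hM0.ne', Real.rpow_one]
  have hofReal : (2 : ℝ≥0∞)⁻¹ ^ (1 / M) = ENNReal.ofReal ((2⁻¹ : ℝ) ^ (1 / M)) := by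
    rw [← ENNReal.ofReal_rpow_of_pos (by norm_num), ENNReal.ofReal_inv_of_pos (by norm_num)]
    simp
  rw [ENNReal.tsum_geometric, hofReal, ← ENNReal.ofReal_one,
    ← ENNReal.ofReal_sub _ (by positivity),
    ← ENNReal.ofReal_inv_of_pos (by have : 0 < (2 * M)⁻¹ := by positivity
                                    linarith)]
  refine ENNReal.ofReal_le_ofReal ?_
  rw [inv_le_comm₀ (by have : 0 < (2 * M)⁻¹ := by positivity
                       linarith) (by positivity)]
  linarith

/-! ### Covering by density and fractional averages -/

namespace IsDyadicGrid

variable {D : Set (Cube n)}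

/-- A finite union of dyadic cubes in each of which `G` has density at least `1 / β`. -/
theorem volume_biUnion_le_of_density (hn : n ≠ 0) (hD : IsDyadicGrid D) {T : Finset (Cube n)}
    (hT : ∀ Q ∈ T, Q ∈ D) (μ : Measure (Fin n → ℝ)) {β : ℝ≥0∞}
    (hβ : ∀ Q ∈ T, volume Q.toSet ≤ β * μ Q.toSet) :
    volume (⋃ Q ∈ T, Q.toSet) ≤ β * μ Set.univ := by
  obtain ⟨T', hT', hd, hc, hcov, -⟩ := hD.exists_maximal hn (T := (T : Set (Cube n)))
    (fun Q hQ => hT Q hQ) (B := ∑ Q ∈ T, Q.side)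
    (fun P hP => Finset.single_le_sum (f := Cube.side) (fun Q _ => Q.side_pos.le) hP)
  have hsub : (⋃ Q ∈ T, Q.toSet) ⊆ ⋃ Q ∈ T', Q.toSet := by
    refine Set.iUnion₂_subset fun Q hQ => ?_
    obtain ⟨R, hR, hQR⟩ := hcov Q hQ
    exact hQR.trans (Set.subset_biUnion_of_mem (u := Cube.toSet) hR)
  calc volume (⋃ Q ∈ T, Q.toSet) ≤ volume (⋃ Q ∈ T', Q.toSet) := measure_mono hsub
    _ = ∑' Q : T', volume (Q : Cube n).toSet := measure_biUnion hc hd fun Q _ => Q.measurableSet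
    _ ≤ ∑' Q : T', β * μ (Q : Cube n).toSet := ENNReal.tsum_le_tsum fun Q => hβ Q (hT' Q.2)
    _ = β * μ (⋃ Q ∈ T', Q.toSet) := by
        rw [ENNReal.tsum_mul_left, measure_biUnion hc hd fun Q _ => Q.measurableSet]
    _ ≤ _ := by gcongr; exact Set.subset_univ _

end IsDyadicGrid

/-- The fractional average `|Q|^{α/n} ⟨h⟩_Q^{1/p}`. -/
noncomputable def fracAvg (α p : ℝ) (h : (Fin n → ℝ) → ℝ≥0∞) (Q : Cube n) : ℝ≥0∞ :=
  volume Q.toSet ^ (α / (n : ℝ)) * (⨍⁻ y in Q.toSet, h y ∂volume) ^ (1 / p)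

section

variable {α p q : ℝ}

/-- The relation between `p`, `q` and `α` makes the powers of `|Q|` cancel exactly. -/
theorem fracAvg_rpow_mul_volume (hp : 1 ≤ p) (hpq : p < q) (hq : 1 / p - 1 / q = α / n)
    (h : (Fin n → ℝ) → ℝ≥0∞) (Q : Cube n) :
    fracAvg α p h Q ^ q * volume Q.toSet = (∫⁻ y in Q.toSet, h y) ^ (q / p) := by
  have hp0 : 0 < p := by linarith
  have hq0 : 0 < q := by linarith
  have hv0 := Q.volume_ne_zero
  have hvt := Q.volume_ne_top
  rw [fracAvg, setLAverage_eq, ENNReal.mul_rpow_of_nonneg _ _ hq0.le, ← ENNReal.rpow_mul,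
    ← ENNReal.rpow_mul, div_eq_mul_inv (∫⁻ y in Q.toSet, h y),
    ENNReal.mul_rpow_of_nonneg _ _ (by positivity), ENNReal.inv_rpow, ← ENNReal.rpow_neg,
    show 1 / p * q = q / p by ring]
  calc _ = (volume Q.toSet ^ (α / n * q) * volume Q.toSet ^ (-(q / p)) * volume Q.toSet ^ (1 : ℝ)) *
        (∫⁻ y in Q.toSet, h y) ^ (q / p) := by rw [ENNReal.rpow_one]; ring
    _ = _ := by
      rw [← ENNReal.rpow_add _ _ hv0 hvt, ← ENNReal.rpow_add _ _ hv0 hvt, ← hq,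
        show (1 / p - 1 / q) * q + -(q / p) + 1 = 0 by field_simp; ring, ENNReal.rpow_zero, one_mul]

/-- The weak type bound of the dyadic fractional maximal operator. -/
theorem IsDyadicGrid.fracAvg_weak_type {D : Set (Cube n)} (hn : n ≠ 0) (hD : IsDyadicGrid D)
    (hp : 1 ≤ p) (hpq : p < q) (hq : 1 / p - 1 / q = α / n) {T : Finset (Cube n)}
    (hT : ∀ Q ∈ T, Q ∈ D) (h : (Fin n → ℝ) → ℝ≥0∞) {s : ℝ≥0∞} (hs : s ≠ 0) (hst : s ≠ ∞)
    (hTs : ∀ Q ∈ T, s < fracAvg α p h Q) :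
    s ^ q * volume (⋃ Q ∈ T, Q.toSet) ≤ (∫⁻ y, h y) ^ (q / p) := by
  have hp0 : 0 < p := by linarith
  have hq0 : 0 < q := by linarith
  have hqp : 0 ≤ q / p - 1 := by rw [sub_nonneg, one_le_div hp0]; exact hpq.le
  have hsq0 : s ^ q ≠ 0 := by simp [hs, hst]
  have hsqt : s ^ q ≠ ∞ := by simp [hs, hst]
  have hsplit : ∀ z : ℝ≥0∞, z ^ (q / p) = z ^ (q / p - 1) * z := by
    intro z
    conv_rhs => rw [← ENNReal.rpow_one z, ← ENNReal.rpow_mul, one_mul]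
    rw [← ENNReal.rpow_add_of_nonneg _ _ hqp zero_le_one, sub_add_cancel]
  -- Of the `q / p` powers of `∫_Q h`, all but one are bounded by the total mass; the last is
  -- additive over the maximal cubes.
  have := hD.volume_biUnion_le_of_density hn hT (volume.withDensity h)
    (β := (s ^ q)⁻¹ * (∫⁻ y, h y) ^ (q / p - 1)) (fun Q hQ => by
      rw [withDensity_apply _ Q.measurableSet, mul_assoc,
        ← ENNReal.mul_le_iff_le_inv hsq0 hsqt]
      calc s ^ q * volume Q.toSet ≤ fracAvg α p h Q ^ q * volume Q.toSet := by
            gcongr; exact (hTs Q hQ).le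
        _ = (∫⁻ y in Q.toSet, h y) ^ (q / p - 1) * ∫⁻ y in Q.toSet, h y := by
            rw [fracAvg_rpow_mul_volume hp hpq hq, hsplit]
        _ ≤ _ := by gcongr; exact Measure.restrict_le_self)
  rw [withDensity_apply _ MeasurableSet.univ, Measure.restrict_univ, mul_assoc, ← hsplit,
    ← ENNReal.mul_le_iff_le_inv hsq0 hsqt] at this
  exact this

/-- Kolmogorov's inequality for the fractional averages over a sparse family. -/
theorem IsDyadicGrid.sum_fracAvg_mul_volume_le {D : Set (Cube n)} (hn : n ≠ 0)
    (hD : IsDyadicGrid D) (hp : 1 ≤ p) (hpq : p < q) (hq : 1 / p - 1 / q = α / n)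
    {T : Finset (Cube n)} (hT : ∀ Q ∈ T, Q ∈ D) {E : Cube n → Set (Fin n → ℝ)}
    (hE : ∀ Q ∈ T, MeasurableSet (E Q) ∧ E Q ⊆ Q.toSet ∧ volume Q.toSet ≤ 2 * volume (E Q))
    (hdisj : (T : Set (Cube n)).PairwiseDisjoint E) {h : (Fin n → ℝ) → ℝ≥0∞}
    (hh0 : ∫⁻ y, h y ≠ 0) (hht : ∫⁻ y, h y ≠ ∞) {V : ℝ≥0∞} (hV0 : V ≠ 0) (hVt : V ≠ ∞)
    (hTV : volume (⋃ Q ∈ T, Q.toSet) ≤ V) :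
    ∑ Q ∈ T, fracAvg α p h Q * volume Q.toSet ≤
      2 * (1 + 2 * 2 * (1 - 2 * 2 ^ (-q))⁻¹) * (∫⁻ y, h y) ^ (1 / p) * V ^ (1 - 1 / q) := by
  have hp0 : 0 < p := by linarith
  have hq0 : 0 < q := by linarith
  set J := ∫⁻ y, h y with hJ
  -- The height at which the weak type bound equals the trivial bound `V`, so that `s ^ q * V = J ^
  -- (q / p)`.
  set s : ℝ≥0∞ := J ^ (1 / p) * V ^ (-(1 / q)) with hs
  have hJp0 : J ^ (1 / p) ≠ 0 := by simp [hh0, hht]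
  have hJpt : J ^ (1 / p) ≠ ∞ := by simp [hh0, hht]
  have hVq0 : V ^ (-(1 / q)) ≠ 0 := by simp [hV0, hVt]
  have hVqt : V ^ (-(1 / q)) ≠ ∞ := by simp [hV0, hVt]
  have hs0 : s ≠ 0 := mul_ne_zero hJp0 hVq0
  have hst : s ≠ ∞ := ENNReal.mul_ne_top hJpt hVqt
  have hsq : s ^ q * V = J ^ (q / p) := by
    rw [hs, ENNReal.mul_rpow_of_nonneg _ _ hq0.le, ← ENNReal.rpow_mul, ← ENNReal.rpow_mul,
      show -(1 / q) * q = -1 by field_simp, ENNReal.rpow_neg_one, mul_assoc,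
      ENNReal.inv_mul_cancel hV0 hVt, mul_one]
    congr 1; ring
  -- The sets `E Q` are disjoint, so `g` equals `fracAvg α p h Q` on `E Q`; sparseness turns the sum
  -- over cubes into `∫ g`, and the weak type bound controls its level sets.
  set g : (Fin n → ℝ) → ℝ≥0∞ := fun x => ∑ Q ∈ T, (E Q).indicator (fun _ => fracAvg α p h Q) x
    with hg
  have hgm : Measurable g :=
    Finset.measurable_fun_sum _ fun Q hQ => measurable_const.indicator (hE Q hQ).1
  have hgx : ∀ Q ∈ T, ∀ x ∈ E Q, g x = fracAvg α p h Q := by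
    intro Q hQ x hx
    rw [hg]
    simp only
    rw [Finset.sum_eq_single_of_mem Q hQ, Set.indicator_of_mem hx]
    intro R hR hne
    exact Set.indicator_of_notMem
      (fun hxR => Set.disjoint_left.1 (hdisj hR hQ hne) hxR hx) _
  have hlayer := lintegral_le_of_layers (volume.restrict (⋃ Q ∈ T, Q.toSet)) hgm hs0
    (ρ := 2) (V := V) (τ := 2 ^ (-q)) (by norm_num) (by simpa using hTV) (fun i => by
      have hρ0 : (2 : ℝ≥0∞) ^ i * s ≠ 0 := mul_ne_zero (by simp) hs0
      have hρt : (2 : ℝ≥0∞) ^ i * s ≠ ∞ := ENNReal.mul_ne_top (by simp) hst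
      have hw := hD.fracAvg_weak_type hn hp hpq hq
        (T := T.filter fun Q => 2 ^ i * s < fracAvg α p h Q)
        (fun Q hQ => hT Q (Finset.mem_filter.1 hQ).1) h hρ0 hρt
        (fun Q hQ => (Finset.mem_filter.1 hQ).2)
      have hsub : {x | 2 ^ i * s < g x} ⊆
          ⋃ Q ∈ T.filter fun Q => 2 ^ i * s < fracAvg α p h Q, Q.toSet := by
        intro x hx
        have hx' : (2 : ℝ≥0∞) ^ i * s < g x := hx
        obtain ⟨Q, hQ, hxQ⟩ : ∃ Q ∈ T, x ∈ E Q := by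
          by_contra hcon
          push Not at hcon
          have : g x = 0 := Finset.sum_eq_zero fun Q hQ => Set.indicator_of_notMem (hcon Q hQ) _
          simp [this] at hx'
        rw [hgx Q hQ x hxQ] at hx'
        exact Set.mem_biUnion (Finset.mem_coe.2 (Finset.mem_filter.2 ⟨hQ, hx'⟩))
          ((hE Q hQ).2.1 hxQ)
      have h2 : ((2 : ℝ≥0∞) ^ (-q)) ^ i = ((2 ^ i) ^ q)⁻¹ := by
        rw [← ENNReal.rpow_natCast, ← ENNReal.rpow_natCast, ← ENNReal.rpow_mul,
          ← ENNReal.rpow_mul, ← ENNReal.rpow_neg]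
        congr 1; ring
      have h20 : ((2 : ℝ≥0∞) ^ i) ^ q ≠ 0 := by simp
      have h2t : ((2 : ℝ≥0∞) ^ i) ^ q ≠ ∞ := by simp
      have hsq0 : s ^ q ≠ 0 := by simp [hs0, hst]
      have hsqt : s ^ q ≠ ∞ := by simp [hs0, hst]
      refine (Measure.restrict_apply_le _ _).trans ((measure_mono hsub).trans ?_)
      rw [ENNReal.mul_rpow_of_nonneg _ _ hq0.le, ← hsq, mul_assoc, mul_left_comm,
        ENNReal.mul_le_mul_iff_right hsq0 hsqt, ENNReal.mul_le_iff_le_inv h20 h2t, ← h2] at hw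
      refine hw.trans ?_
      rw [mul_assoc]
      exact le_mul_of_one_le_left' one_le_two)
  have hint : ∫⁻ x in ⋃ Q ∈ T, Q.toSet, g x = ∑ Q ∈ T, fracAvg α p h Q * volume (E Q) := by
    rw [hg, lintegral_finsetSum' _ fun Q hQ =>
      (measurable_const.indicator (hE Q hQ).1).aemeasurable]
    refine Finset.sum_congr rfl fun Q hQ => ?_
    rw [lintegral_indicator_const (hE Q hQ).1, Measure.restrict_apply (hE Q hQ).1,
      Set.inter_eq_left.2]
    exact (hE Q hQ).2.1.trans (Set.subset_biUnion_of_mem (u := Cube.toSet) (Finset.mem_coe.2 hQ))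
  rw [hint] at hlayer
  have hsV : s * V = J ^ (1 / p) * V ^ (1 - 1 / q) := by
    rw [hs, mul_assoc]
    congr 1
    conv_lhs => rw [← ENNReal.rpow_one V, ← ENNReal.rpow_mul, one_mul]
    rw [← ENNReal.rpow_add _ _ hV0 hVt]
    congr 1; ring
  calc ∑ Q ∈ T, fracAvg α p h Q * volume Q.toSet
      ≤ ∑ Q ∈ T, 2 * (fracAvg α p h Q * volume (E Q)) := by
        refine Finset.sum_le_sum fun Q hQ => ?_
        rw [mul_left_comm]
        gcongr
        exact (hE Q hQ).2.2
    _ ≤ 2 * (s * V * (1 + 2 * 2 * (1 - 2 * 2 ^ (-q))⁻¹)) := by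
        rw [← Finset.mul_sum]; gcongr
    _ = _ := by rw [hsV]; ring

end

/-! ### The sparse form on a level set -/

theorem one_lt_two_rpow {z : ℝ} (hz : 0 < z) : (1 : ℝ≥0∞) < 2 ^ z := by
  simpa using ENNReal.rpow_lt_rpow_of_exponent_lt (x := 2) (y := 0) (z := z) (by norm_num)
    (by norm_num) hz

/-- The integral of `u^{1/q}` over a subset of `Q` of density at most `b^{-m}`, for a weight
whose level sets on `Q` decay like `b^{-k}`. -/
theorem setLIntegral_rpow_le {q : ℝ} (hq : 1 < q) {u : (Fin n → ℝ) → ℝ≥0∞} (hu : Measurable u)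
    {Q : Cube n} {t b : ℝ≥0∞} (ht0 : t ≠ 0) (htt : t ≠ ∞) (hb : 2 ≤ b) (hbt : b ≠ ∞)
    (hlevel : ∀ k : ℕ, b ^ k * volume (Q.toSet ∩ {x | 2 ^ k * t < u x}) ≤ 2 * volume Q.toSet)
    {G : Set (Fin n → ℝ)} {m : ℕ} (hG : b ^ m * volume (Q.toSet ∩ G) ≤ volume Q.toSet) :
    b ^ m * ∫⁻ x in Q.toSet ∩ G, u x ^ (1 / q) ≤
      (1 + 2 * 2 ^ (1 / q) * (1 - 2 ^ (1 / q) * 2⁻¹)⁻¹) * (2 ^ (1 / q)) ^ m *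
        (t ^ (1 / q) * volume Q.toSet) := by
  have hq0 : 0 < q := by linarith
  have hqi : 0 < 1 / q := by positivity
  have hb0 : b ≠ 0 := (lt_of_lt_of_le (by norm_num) hb).ne'
  have hbm0 : ∀ k : ℕ, b ^ k ≠ 0 := fun k => pow_ne_zero k hb0
  have hbmt : ∀ k : ℕ, b ^ k ≠ ∞ := fun k => ENNReal.pow_ne_top hbt
  -- The layers start at `u = 2 ^ m * t`: below it the measure of `Q ∩ G` is the better bound, above
  -- it the decay of the level sets. Since `b ≥ 2`, the ratio `2^{1/q} / 2` sums uniformly in `b`.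
  have hlayer := lintegral_le_of_layers (volume.restrict (Q.toSet ∩ G)) (hu.pow_const (1 / q))
    (s := (2 ^ (1 / q)) ^ m * t ^ (1 / q)) (ρ := 2 ^ (1 / q)) (V := (b ^ m)⁻¹ * volume Q.toSet)
    (τ := 2⁻¹)
    (mul_ne_zero (pow_ne_zero _ (one_lt_two_rpow hqi).ne_bot) (by simp [ht0, htt]))
    (one_lt_two_rpow hqi)
    (by rw [Measure.restrict_apply_univ]
        exact (ENNReal.mul_le_iff_le_inv (hbm0 m) (hbmt m)).1 hG)
    (fun i => by
      have hset : {x | (2 ^ (1 / q)) ^ i * ((2 ^ (1 / q)) ^ m * t ^ (1 / q)) < u x ^ (1 / q)}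
          = {x | 2 ^ (m + i) * t < u x} := by
        ext x
        have : ((2 : ℝ≥0∞) ^ (1 / q)) ^ i * ((2 ^ (1 / q)) ^ m * t ^ (1 / q))
            = (2 ^ (m + i) * t) ^ (1 / q) := by
          rw [ENNReal.mul_rpow_of_nonneg _ _ hqi.le, ← mul_assoc, ← pow_add,
            ← ENNReal.rpow_natCast, ← ENNReal.rpow_natCast, ← ENNReal.rpow_mul,
            ← ENNReal.rpow_mul, mul_comm (1 / q), add_comm i m]
        simp only [Set.mem_ofPred_eq]
        rw [this, ENNReal.rpow_lt_rpow_iff hqi]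
      rw [hset, Measure.restrict_apply (measurableSet_lt measurable_const hu)]
      have h1 : volume ({x | 2 ^ (m + i) * t < u x} ∩ (Q.toSet ∩ G)) ≤
          (b ^ (m + i))⁻¹ * (2 * volume Q.toSet) := by
        rw [← ENNReal.mul_le_iff_le_inv (hbm0 _) (hbmt _)]
        refine (mul_le_mul_right (measure_mono ?_) _).trans (hlevel (m + i))
        exact fun x hx => ⟨hx.2.1, hx.1⟩
      refine h1.trans ?_
      rw [pow_add, ENNReal.mul_inv (Or.inl (hbm0 _)) (Or.inl (hbmt _)), ENNReal.inv_pow (n := i)]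
      calc (b ^ m)⁻¹ * b⁻¹ ^ i * (2 * volume Q.toSet)
          ≤ (b ^ m)⁻¹ * 2⁻¹ ^ i * (2 * volume Q.toSet) := by gcongr
        _ = _ := by ring)
  calc b ^ m * ∫⁻ x in Q.toSet ∩ G, u x ^ (1 / q)
      ≤ b ^ m * ((2 ^ (1 / q)) ^ m * t ^ (1 / q) * ((b ^ m)⁻¹ * volume Q.toSet) *
          (1 + 2 * 2 ^ (1 / q) * (1 - 2 ^ (1 / q) * 2⁻¹)⁻¹)) := by gcongr
    _ = (b ^ m * (b ^ m)⁻¹) * ((1 + 2 * 2 ^ (1 / q) * (1 - 2 ^ (1 / q) * 2⁻¹)⁻¹) *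
          (2 ^ (1 / q)) ^ m * (t ^ (1 / q) * volume Q.toSet)) := by ring
    _ = _ := by rw [ENNReal.mul_inv_cancel (hbm0 _) (hbmt _), one_mul]

/-- A constant depending only on `q`. -/
noncomputable def sparseConst (q : ℝ) : ℝ≥0∞ :=
  (1 + 2 * 2 ^ (1 / q) * (1 - 2 ^ (1 / q) * 2⁻¹)⁻¹) *
    (2 * (1 + 2 * 2 * (1 - 2 * 2 ^ (-q))⁻¹)) * 4 * ENNReal.ofReal (2 * q)

/-- The ratios `2^{1/q - 1}` and `2^{1 - q}` of the two geometric series are below one because `q >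
1`. -/
theorem sparseConst_ne_top {q : ℝ} (hq : 1 < q) : sparseConst q ≠ ∞ := by
  have h1 : (1 : ℝ≥0∞) - 2 ^ (1 / q) * 2⁻¹ ≠ 0 := by
    rw [Ne, tsub_eq_zero_iff_le, not_le, ← div_eq_mul_inv,
      ENNReal.div_lt_iff (by simp) (by simp), one_mul]
    simpa using ENNReal.rpow_lt_rpow_of_exponent_lt (x := 2) (y := 1 / q) (z := 1) (by norm_num)
      (by norm_num) (by rw [div_lt_one (by linarith)]; exact hq)
  have h2 : (1 : ℝ≥0∞) - 2 * 2 ^ (-q) ≠ 0 := by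
    rw [Ne, tsub_eq_zero_iff_le, not_le]
    have h := ENNReal.rpow_lt_rpow_of_exponent_lt (x := 2) (y := 1 + -q) (z := 0) (by norm_num)
      (by norm_num) (by linarith)
    rwa [ENNReal.rpow_add _ _ (by norm_num) (by norm_num), ENNReal.rpow_one,
      ENNReal.rpow_zero] at h
  have h3 : (2 : ℝ≥0∞) ^ (1 / q) ≠ ∞ := by
    refine ENNReal.rpow_ne_top_of_nonneg ?_ (by simp)
    have : 0 < q := by linarith
    positivity
  unfold sparseConst
  finiteness

theorem exists_pow_density {b v g : ℝ≥0∞} (hb : 1 < b) (hg0 : g ≠ 0) (hgv : g ≤ v)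
    (hvt : v ≠ ∞) : ∃ m : ℕ, b ^ m * g ≤ v ∧ v ≤ b ^ (m + 1) * g := by
  have hex : ∃ m : ℕ, v < b ^ m * g := by
    have h := ENNReal.Tendsto.mul_const
      (ENNReal.tendsto_pow_atTop_nhds_top_iff.2 hb) (b := g) (Or.inl ENNReal.top_ne_zero)
    rw [ENNReal.top_mul hg0] at h
    exact (h.eventually_const_lt (lt_top_iff_ne_top.2 hvt)).exists
  classical
  rcases Nat.exists_eq_succ_of_ne_zero (n := Nat.find hex) (fun h0 => by
    have := Nat.find_spec hex
    rw [h0, pow_zero, one_mul] at this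
    exact absurd hgv (not_le.2 this)) with ⟨m, hm⟩
  refine ⟨m, not_lt.1 (Nat.find_min hex (by omega)), ?_⟩
  have := Nat.find_spec hex
  rw [hm] at this
  exact this.le

/-- The sparse form bound: the `A_∞` decay exponent `N` enters linearly. -/
theorem IsDyadicGrid.sum_mul_setLIntegral_le {D : Set (Cube n)} {α p q : ℝ} (hn : n ≠ 0)
    (hD : IsDyadicGrid D) (hp : 1 ≤ p) (hpq : p < q) (hq : 1 / p - 1 / q = α / n)
    {S : Finset (Cube n)} (hS : ∀ Q ∈ S, Q ∈ D) {E : Cube n → Set (Fin n → ℝ)}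
    (hE : ∀ Q ∈ S, MeasurableSet (E Q) ∧ E Q ⊆ Q.toSet ∧ volume Q.toSet ≤ 2 * volume (E Q))
    (hdisj : (S : Set (Cube n)).PairwiseDisjoint E) {h : (Fin n → ℝ) → ℝ≥0∞}
    (hh0 : ∫⁻ y, h y ≠ 0) (hht : ∫⁻ y, h y ≠ ∞)
    {u : (Fin n → ℝ) → ℝ≥0∞} (hu : Measurable u) {t : Cube n → ℝ≥0∞}
    (ht0 : ∀ Q ∈ S, t Q ≠ 0) (htt : ∀ Q ∈ S, t Q ≠ ∞) {N : ℕ} (hN : N ≠ 0)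
    (hlevel : ∀ Q ∈ S, ∀ k : ℕ, (2 * 2 ^ (1 / N : ℝ)) ^ k *
      volume (Q.toSet ∩ {x | 2 ^ k * t Q < u x}) ≤ 2 * volume Q.toSet)
    {a : Cube n → ℝ≥0∞} {K : ℝ≥0∞}
    (ha : ∀ Q ∈ S, a Q * t Q ^ (1 / q) ≤ K * fracAvg α p h Q)
    {G : Set (Fin n → ℝ)} (hG0 : volume G ≠ 0) (hGt : volume G ≠ ∞) :
    ∑ Q ∈ S, a Q * ∫⁻ x in Q.toSet ∩ G, u x ^ (1 / q) ≤
      sparseConst q * N * K * (∫⁻ y, h y) ^ (1 / p) * volume G ^ (1 - 1 / q) := by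
  have hq1 : 1 < q := by linarith
  have hq0 : 0 < q := by linarith
  have hqi : 0 < 1 / q := by positivity
  have hqi' : 0 ≤ 1 - 1 / q := by rw [sub_nonneg, div_le_one hq0]; exact hq1.le
  set C2 : ℝ≥0∞ := 1 + 2 * 2 ^ (1 / q) * (1 - 2 ^ (1 / q) * 2⁻¹)⁻¹ with hC2
  set C1 : ℝ≥0∞ := 2 * (1 + 2 * 2 * (1 - 2 * 2 ^ (-q))⁻¹) with hC1
  set β : ℝ≥0∞ := 2 ^ (1 / N : ℝ) with hβ
  -- The density classes use the decay base of the level sets, so that in class `m` the bound for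
  -- the set `u > 2 ^ m * t Q` matches the size of `Q ∩ G`.
  set b : ℝ≥0∞ := 2 * β with hb
  have hN1 : (1 : ℝ) ≤ N := by exact_mod_cast Nat.one_le_iff_ne_zero.2 hN
  have hNi : 0 < 1 / (N : ℝ) := by positivity
  have hβ1 : 1 < β := one_lt_two_rpow hNi
  have hβ2 : β ≤ 2 := by
    have := ENNReal.rpow_le_rpow_of_exponent_le (x := 2) one_le_two
      (show 1 / (N : ℝ) ≤ 1 by rw [div_le_one (by linarith)]; exact hN1)
    rwa [ENNReal.rpow_one] at this
  have hb2 : 2 ≤ b := le_mul_of_one_le_right' hβ1.le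
  have hb4 : b ≤ 4 := by
    calc b ≤ 2 * 2 := by rw [hb]; gcongr
      _ = 4 := by norm_num
  have hbt : b ≠ ∞ := (hb4.trans_lt (by norm_num)).ne
  have hb1 : 1 < b := lt_of_lt_of_le (by norm_num) hb2
  have hb0 : b ≠ 0 := hb1.ne_bot
  have hex : ∀ Q : Cube n, ∃ m : ℕ, volume (Q.toSet ∩ G) ≠ 0 →
      b ^ m * volume (Q.toSet ∩ G) ≤ volume Q.toSet ∧
        volume Q.toSet ≤ b ^ (m + 1) * volume (Q.toSet ∩ G) := by
    intro Q
    by_cases h0 : volume (Q.toSet ∩ G) = 0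
    · exact ⟨0, fun h => absurd h0 h⟩
    · obtain ⟨m, hm⟩ := exists_pow_density hb1 h0 (measure_mono Set.inter_subset_left)
        Q.volume_ne_top
      exact ⟨m, fun _ => hm⟩
  choose m hm using hex
  classical
  set S' := S.filter fun Q => volume (Q.toSet ∩ G) ≠ 0 with hS'
  have hsum : ∑ Q ∈ S, a Q * ∫⁻ x in Q.toSet ∩ G, u x ^ (1 / q) =
      ∑ Q ∈ S', a Q * ∫⁻ x in Q.toSet ∩ G, u x ^ (1 / q) := by
    refine (Finset.sum_filter_of_ne (p := fun Q : Cube n => volume (Q.toSet ∩ G) ≠ 0)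
      fun Q _ hne h0 => hne ?_).symm
    rw [Measure.restrict_eq_zero.2 h0, lintegral_zero_measure, mul_zero]
  -- The net ratio between consecutive density classes, `(2 / b) ^ (1 / q)`.
  have hr : (2 : ℝ≥0∞)⁻¹ ^ (1 / (N * q)) = 2 ^ (1 / q) * (b ^ (1 / q))⁻¹ := by
    rw [hb, ENNReal.mul_rpow_of_nonneg _ _ hqi.le, hβ, ← ENNReal.rpow_mul,
      ENNReal.mul_inv (by simp) (Or.inl (by simp)), ← mul_assoc,
      ENNReal.mul_inv_cancel (by simp) (by simp),
      one_mul, ENNReal.inv_rpow]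
    congr 2; field_simp
  have hfiber : ∀ j : ℕ, ∑ Q ∈ S' with m Q = j, a Q * ∫⁻ x in Q.toSet ∩ G, u x ^ (1 / q) ≤
      C2 * C1 * 4 * K * (∫⁻ y, h y) ^ (1 / p) * volume G ^ (1 - 1 / q) *
        ((2 : ℝ≥0∞)⁻¹ ^ (1 / (N * q))) ^ j := by
    intro j
    set T := S'.filter fun Q => m Q = j with hT
    have hTmem : ∀ Q ∈ T, Q ∈ S ∧ volume (Q.toSet ∩ G) ≠ 0 ∧ m Q = j := by
      intro Q hQ
      rw [hT, Finset.mem_filter, hS', Finset.mem_filter] at hQ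
      exact ⟨hQ.1.1, hQ.1.2, hQ.2⟩
    have hbj0 : b ^ j ≠ 0 := pow_ne_zero _ hb0
    have hbjt : b ^ j ≠ ∞ := ENNReal.pow_ne_top hbt
    have hV : volume (⋃ Q ∈ T, Q.toSet) ≤ b ^ (j + 1) * volume G := by
      have := hD.volume_biUnion_le_of_density hn (T := T) (fun Q hQ => hS Q (hTmem Q hQ).1)
        (volume.restrict G) (β := b ^ (j + 1)) (fun Q hQ => by
          obtain ⟨-, h0, hmj⟩ := hTmem Q hQ
          rw [Measure.restrict_apply Q.measurableSet, ← hmj]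
          exact (hm Q h0).2)
      rwa [Measure.restrict_apply_univ] at this
    have hK := hD.sum_fracAvg_mul_volume_le hn hp hpq hq (T := T)
      (fun Q hQ => hS Q (hTmem Q hQ).1) (fun Q hQ => hE Q (hTmem Q hQ).1)
      (hdisj.subset fun Q hQ => (hTmem Q hQ).1) hh0 hht
      (mul_ne_zero (pow_ne_zero _ hb0) hG0) (ENNReal.mul_ne_top (ENNReal.pow_ne_top hbt) hGt) hV
    have hstep : b ^ j * ∑ Q ∈ T, a Q * ∫⁻ x in Q.toSet ∩ G, u x ^ (1 / q) ≤
        C2 * (2 ^ (1 / q)) ^ j * K * (C1 * (∫⁻ y, h y) ^ (1 / p) *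
          (b ^ (j + 1) * volume G) ^ (1 - 1 / q)) := by
      refine le_trans ?_ (mul_le_mul_right hK _)
      rw [Finset.mul_sum, Finset.mul_sum]
      refine Finset.sum_le_sum fun Q hQ => ?_
      obtain ⟨hQS, h0, hmj⟩ := hTmem Q hQ
      have hB := setLIntegral_rpow_le hq1 hu (ht0 Q hQS) (htt Q hQS) hb2 hbt (hlevel Q hQS)
        (hm Q h0).1
      rw [hmj] at hB
      calc b ^ j * (a Q * ∫⁻ x in Q.toSet ∩ G, u x ^ (1 / q))
          = a Q * (b ^ j * ∫⁻ x in Q.toSet ∩ G, u x ^ (1 / q)) := by ring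
        _ ≤ a Q * (C2 * (2 ^ (1 / q)) ^ j * (t Q ^ (1 / q) * volume Q.toSet)) := by gcongr
        _ = C2 * (2 ^ (1 / q)) ^ j * (a Q * t Q ^ (1 / q)) * volume Q.toSet := by ring
        _ ≤ C2 * (2 ^ (1 / q)) ^ j * (K * fracAvg α p h Q) * volume Q.toSet :=
            mul_le_mul_left (mul_le_mul_right (ha Q hQS) _) _
        _ = _ := by ring
    refine (ENNReal.mul_le_mul_iff_right hbj0 hbjt).1 (hstep.trans ?_)
    have hpow : (b ^ (j + 1)) ^ (1 - 1 / q) ≤ b ^ j * 4 * ((b ^ (1 / q))⁻¹) ^ j := by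
      have hle : b ^ (1 - 1 / q) ≤ 4 := by
        refine le_trans ?_ hb4
        have := ENNReal.rpow_le_rpow_of_exponent_le hb1.le (show 1 - 1 / q ≤ 1 by linarith)
        rwa [ENNReal.rpow_one] at this
      have heq : b ^ (1 - 1 / q) = b * (b ^ (1 / q))⁻¹ := by
        rw [ENNReal.rpow_sub _ _ hb0 hbt, ENNReal.rpow_one, div_eq_mul_inv]
      calc (b ^ (j + 1)) ^ (1 - 1 / q) = (b ^ (1 - 1 / q)) ^ (j + 1) := by
            rw [← ENNReal.rpow_natCast, ← ENNReal.rpow_natCast, ← ENNReal.rpow_mul,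
              ← ENNReal.rpow_mul, mul_comm]
        _ = (b ^ (1 - 1 / q)) ^ j * b ^ (1 - 1 / q) := pow_succ _ _
        _ ≤ (b ^ (1 - 1 / q)) ^ j * 4 := by gcongr
        _ = _ := by rw [heq, mul_pow]; ring
    rw [ENNReal.mul_rpow_of_nonneg _ _ hqi', hr, mul_pow (2 ^ (1 / q)) ((b ^ (1 / q))⁻¹) j]
    calc C2 * (2 ^ (1 / q)) ^ j * K * (C1 * (∫⁻ y, h y) ^ (1 / p) *
          ((b ^ (j + 1)) ^ (1 - 1 / q) * volume G ^ (1 - 1 / q)))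
        ≤ C2 * (2 ^ (1 / q)) ^ j * K * (C1 * (∫⁻ y, h y) ^ (1 / p) *
          ((b ^ j * 4 * ((b ^ (1 / q))⁻¹) ^ j) * volume G ^ (1 - 1 / q))) := by gcongr
      _ = _ := by ring
  rw [hsum, ← Finset.sum_fiberwise_of_maps_to (g := m) (t := S'.image m)
    (fun Q hQ => Finset.mem_image_of_mem m hQ)]
  calc ∑ j ∈ S'.image m, ∑ Q ∈ S' with m Q = j, a Q * ∫⁻ x in Q.toSet ∩ G, u x ^ (1 / q)
      ≤ ∑ j ∈ S'.image m, C2 * C1 * 4 * K * (∫⁻ y, h y) ^ (1 / p) * volume G ^ (1 - 1 / q) *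
        ((2 : ℝ≥0∞)⁻¹ ^ (1 / (N * q))) ^ j := Finset.sum_le_sum fun j _ => hfiber j
    _ ≤ ∑' j : ℕ, C2 * C1 * 4 * K * (∫⁻ y, h y) ^ (1 / p) * volume G ^ (1 - 1 / q) *
        ((2 : ℝ≥0∞)⁻¹ ^ (1 / (N * q))) ^ j := ENNReal.sum_le_tsum _
    _ ≤ C2 * C1 * 4 * K * (∫⁻ y, h y) ^ (1 / p) * volume G ^ (1 - 1 / q) *
        ENNReal.ofReal (2 * (N * q)) := by
      rw [ENNReal.tsum_mul_left]
      gcongr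
      exact tsum_dyadic_root_le (one_le_mul_of_one_le_of_one_le hN1 hq1.le)
    _ = _ := by
      rw [sparseConst, show 2 * (N * q) = 2 * q * N by ring, ENNReal.ofReal_mul (by linarith),
        ENNReal.ofReal_natCast]
      ring

/-- The weak type bound for a finite sparse sum. -/
theorem IsDyadicGrid.volume_finite_sparse_le {D : Set (Cube n)} {α p q : ℝ} (hn : n ≠ 0)
    (hD : IsDyadicGrid D) (hp : 1 ≤ p) (hpq : p < q) (hq : 1 / p - 1 / q = α / n)
    {S : Finset (Cube n)} (hS : ∀ Q ∈ S, Q ∈ D) {E : Cube n → Set (Fin n → ℝ)}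
    (hE : ∀ Q ∈ S, MeasurableSet (E Q) ∧ E Q ⊆ Q.toSet ∧ volume Q.toSet ≤ 2 * volume (E Q))
    (hdisj : (S : Set (Cube n)).PairwiseDisjoint E) {h : (Fin n → ℝ) → ℝ≥0∞}
    (hh0 : ∫⁻ y, h y ≠ 0) (hht : ∫⁻ y, h y ≠ ∞)
    {u : (Fin n → ℝ) → ℝ≥0∞} (hu : Measurable u) {t : Cube n → ℝ≥0∞}
    (ht0 : ∀ Q ∈ S, t Q ≠ 0) (htt : ∀ Q ∈ S, t Q ≠ ∞) {N : ℕ} (hN : N ≠ 0)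
    (hlevel : ∀ Q ∈ S, ∀ k : ℕ, (2 * 2 ^ (1 / N : ℝ)) ^ k *
      volume (Q.toSet ∩ {x | 2 ^ k * t Q < u x}) ≤ 2 * volume Q.toSet)
    {a : Cube n → ℝ≥0∞} {K : ℝ≥0∞}
    (ha : ∀ Q ∈ S, a Q * t Q ^ (1 / q) ≤ K * fracAvg α p h Q)
    {l : ℝ≥0∞} (hl0 : l ≠ 0) (hlt : l ≠ ∞) :
    volume {x | l < u x ^ (1 / q) * ∑ Q ∈ S, Q.toSet.indicator (fun _ => a Q) x} ≤
      (sparseConst q * N * K * (∫⁻ y, h y) ^ (1 / p) / l) ^ q := by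
  have hq0 : 0 < q := by linarith
  set F : (Fin n → ℝ) → ℝ≥0∞ :=
    fun x => u x ^ (1 / q) * ∑ Q ∈ S, Q.toSet.indicator (fun _ => a Q) x with hF
  have hFm : Measurable F := (hu.pow_const _).mul
    (Finset.measurable_fun_sum _ fun Q _ => measurable_const.indicator Q.measurableSet)
  set G := {x | l < F x} with hGdef
  rcases eq_or_ne (volume G) 0 with hG0 | hG0
  · rw [hG0]; exact zero_le
  -- Finiteness of the family is used here: `G` lies in a finite union of cubes, so `|G|^{1 - 1/q}`
  -- can be divided out below.
  have hGt : volume G ≠ ∞ := by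
    have hsub : G ⊆ ⋃ Q ∈ S, Q.toSet := by
      intro x hx
      by_contra hcon
      simp only [Set.mem_iUnion, not_exists] at hcon
      have h0 : F x = 0 := by
        rw [hF]
        simp only
        rw [Finset.sum_eq_zero fun Q hQ => Set.indicator_of_notMem (hcon Q hQ) _, mul_zero]
      have hx' : l < F x := hx
      simp [h0] at hx'
    refine ((measure_mono hsub).trans_lt ?_).ne
    refine (measure_biUnion_finset_le S _).trans_lt ?_
    exact ENNReal.sum_lt_top.2 fun Q _ => lt_top_iff_ne_top.2 Q.volume_ne_top
  have hcheb : l * volume G ≤ ∑ Q ∈ S, a Q * ∫⁻ x in Q.toSet ∩ G, u x ^ (1 / q) := by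
    calc l * volume G = ∫⁻ x in G, l := by rw [setLIntegral_const]
      _ ≤ ∫⁻ x in G, F x := setLIntegral_mono hFm fun x hx => le_of_lt hx
      _ = ∫⁻ x in G, ∑ Q ∈ S, Q.toSet.indicator (fun x => a Q * u x ^ (1 / q)) x := by
          refine lintegral_congr fun x => ?_
          rw [hF]
          simp only
          rw [Finset.mul_sum]
          refine Finset.sum_congr rfl fun Q _ => ?_
          by_cases hx : x ∈ Q.toSet
          · simp [hx, mul_comm]
          · simp [hx]
      _ = _ := by
          rw [lintegral_finsetSum _ fun Q _ =>
            ((hu.pow_const _).const_mul _).indicator Q.measurableSet]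
          refine Finset.sum_congr rfl fun Q _ => ?_
          rw [setLIntegral_indicator Q.measurableSet, lintegral_const_mul _ (hu.pow_const _)]
  have hmain := hcheb.trans (hD.sum_mul_setLIntegral_le hn hp hpq hq hS hE hdisj hh0 hht hu ht0
    htt hN hlevel ha hG0 hGt)
  have hGq0 : volume G ^ (1 - 1 / q) ≠ 0 := by simp [hG0, hGt]
  have hGqt : volume G ^ (1 - 1 / q) ≠ ∞ := by simp [hG0, hGt]
  have hsplit : l * volume G = l * volume G ^ (1 / q) * volume G ^ (1 - 1 / q) := by
    rw [mul_assoc, ← ENNReal.rpow_add _ _ hG0 hGt, add_sub_cancel, ENNReal.rpow_one]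
  rw [hsplit, ENNReal.mul_le_mul_iff_left hGq0 hGqt] at hmain
  have h1 : volume G ^ (1 / q) ≤ sparseConst q * N * K * (∫⁻ y, h y) ^ (1 / p) / l := by
    rw [ENNReal.le_div_iff_mul_le (Or.inl hl0) (Or.inl hlt), mul_comm]
    exact hmain
  calc volume G = (volume G ^ (1 / q)) ^ q := by
        rw [← ENNReal.rpow_mul, one_div_mul_cancel hq0.ne', ENNReal.rpow_one]
    _ ≤ _ := ENNReal.rpow_le_rpow h1 hq0.le

/-! ### Weights and their characteristics -/

theorem Cube.setLIntegral_ne_zero (Q : Cube n) {g : (Fin n → ℝ) → ℝ≥0∞} (hg : AEMeasurable g)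
    (hpos : ∀ᵐ x, g x ≠ 0) : ∫⁻ x in Q.toSet, g x ≠ 0 := by
  intro h0
  rw [lintegral_eq_zero_iff' hg.restrict] at h0
  have hfalse : ∀ᵐ x ∂(volume.restrict Q.toSet), False := by
    filter_upwards [h0, ae_restrict_of_ae hpos] with x hx hx' using hx' hx
  rw [ae_iff] at hfalse
  simp only [not_false_eq_true] at hfalse
  rw [show {a : Fin n → ℝ | True} = Set.univ from Set.eq_univ_of_forall fun _ => trivial,
    Measure.restrict_apply_univ] at hfalse
  exact Q.volume_ne_zero hfalse

theorem Cube.setLAverage_ne_zero (Q : Cube n) {g : (Fin n → ℝ) → ℝ≥0∞} (hg : AEMeasurable g)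
    (hpos : ∀ᵐ x, g x ≠ 0) : ⨍⁻ x in Q.toSet, g x ∂volume ≠ 0 := by
  rw [setLAverage_eq]
  exact (ENNReal.div_pos (Q.setLIntegral_ne_zero hg hpos) Q.volume_ne_top).ne'

theorem Cube.setLAverage_congr (Q : Cube n) {g h : (Fin n → ℝ) → ℝ≥0∞} (hgh : g =ᵐ[volume] h) :
    ⨍⁻ x in Q.toSet, g x ∂volume = ⨍⁻ x in Q.toSet, h x ∂volume := by
  rw [setLAverage_eq, setLAverage_eq, lintegral_congr_ae (ae_restrict_of_ae hgh)]

section Weight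

variable {p q : ℝ} {w : (Fin n → ℝ) → ℝ}

theorem IsWeight.aemeasurable_rpow (hw : IsWeight w) (r : ℝ) :
    AEMeasurable (fun x => ENNReal.ofReal (w x) ^ r) volume :=
  hw.1.ennreal_ofReal.pow_const r

theorem IsWeight.ae_rpow_ne_zero (hw : IsWeight w) (r : ℝ) :
    ∀ᵐ x ∂(volume : Measure (Fin n → ℝ)), ENNReal.ofReal (w x) ^ r ≠ 0 := by
  filter_upwards [hw.2] with x hx
  simp [hx]

theorem IsWeight.essSup_ne_zero (hw : IsWeight w) (r : ℝ) (Q : Cube n) :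
    essSup (fun x => ENNReal.ofReal (w x) ^ r) (volume.restrict Q.toSet) ≠ 0 := by
  intro h0
  rw [ENNReal.essSup_eq_zero_iff] at h0
  refine Q.setLIntegral_ne_zero (hw.aemeasurable_rpow r) (hw.ae_rpow_ne_zero r) ?_
  rw [lintegral_congr_ae h0]
  simp

/-- The other factor in the characteristic is nonzero, so an infinite average would make the product
infinite. -/
theorem MemApq.setLAverage_ne_top (hp : 1 ≤ p) (hq : 0 < q) (hw : MemApq p q w) (Q : Cube n) :
    ⨍⁻ x in Q.toSet, ENNReal.ofReal (w x) ^ q ∂volume ≠ ∞ := by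
  intro htop
  refine hw.2.ne (top_le_iff.1 ?_)
  rw [apqChar]
  split_ifs with h1
  · refine le_trans ?_ (le_iSup _ Q)
    rw [htop, ENNReal.mul_top (hw.1.essSup_ne_zero _ Q)]
  · refine le_trans ?_ (le_iSup _ Q)
    have hp1 : 1 < p := lt_of_le_of_ne hp (Ne.symm h1)
    have hp' : 0 < p / (p - 1) := div_pos (by linarith) (by linarith)
    have hs := Q.setLAverage_ne_zero (hw.1.aemeasurable_rpow (-(p / (p - 1))))
      (hw.1.ae_rpow_ne_zero _)
    rw [htop, ENNReal.top_mul]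
    have : 0 < q / (p / (p - 1)) := by positivity
    simp [hs, this.not_gt]

theorem MemApq.setLIntegral_ne_top (hp : 1 ≤ p) (hq : 0 < q) (hw : MemApq p q w) (Q : Cube n) :
    ∫⁻ x in Q.toSet, ENNReal.ofReal (w x) ^ q ≠ ∞ := by
  have := hw.setLAverage_ne_top hp hq Q
  rw [setLAverage_eq] at this
  intro h
  rw [h, ENNReal.top_div_of_ne_top Q.volume_ne_top] at this
  exact this rfl

/-- The averages of `f w⁻¹` are controlled by the `A_{p,q}` characteristic. -/
theorem IsWeight.setLAverage_mul_inv_le (hp : 1 ≤ p) (hq : 0 < q) (hw : IsWeight w)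
    {f : (Fin n → ℝ) → ℝ} (hf : AEMeasurable f volume) (hf0 : ∀ᵐ x ∂volume, 0 ≤ f x) (Q : Cube n) :
    (⨍⁻ x in Q.toSet, ENNReal.ofReal (f x * (w x)⁻¹) ∂volume) *
        (⨍⁻ x in Q.toSet, ENNReal.ofReal (w x) ^ q ∂volume) ^ (1 / q) ≤
      apqChar p q w ^ (1 / q) * (⨍⁻ x in Q.toSet, ‖f x‖ₑ ^ p ∂volume) ^ (1 / p) := by
  have hqi : 0 < 1 / q := by positivity
  have hfw : (fun x => ENNReal.ofReal (f x * (w x)⁻¹)) =ᵐ[volume]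
      fun x => ‖f x‖ₑ * (ENNReal.ofReal (w x))⁻¹ := by
    filter_upwards [hf0, hw.2] with x hx hwx
    rw [ENNReal.ofReal_mul hx, ENNReal.ofReal_inv_of_pos hwx, Real.enorm_eq_ofReal hx]
  rw [Q.setLAverage_congr hfw]
  rw [apqChar]
  split_ifs with h1
  · subst h1
    set e := essSup (fun x => ENNReal.ofReal (w x) ^ (-q)) (volume.restrict Q.toSet) with he
    have hle : ⨍⁻ x in Q.toSet, ‖f x‖ₑ * (ENNReal.ofReal (w x))⁻¹ ∂volume ≤
        (⨍⁻ x in Q.toSet, ‖f x‖ₑ ∂volume) * e ^ (1 / q) := by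
      rw [setLAverage_eq, setLAverage_eq, div_eq_mul_inv, div_eq_mul_inv, mul_right_comm]
      gcongr
      rw [← lintegral_mul_const'' _ hf.enorm.restrict]
      refine lintegral_mono_ae ?_
      filter_upwards [ENNReal.ae_le_essSup (μ := volume.restrict Q.toSet)
        (fun x => ENNReal.ofReal (w x) ^ (-q))] with x hx
      gcongr
      calc (ENNReal.ofReal (w x))⁻¹ = (ENNReal.ofReal (w x) ^ (-q)) ^ (1 / q) := by
            rw [← ENNReal.rpow_mul, show -q * (1 / q) = -1 by field_simp, ENNReal.rpow_neg_one]
        _ ≤ e ^ (1 / q) := ENNReal.rpow_le_rpow hx hqi.le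
    simp only [ENNReal.rpow_one, one_div_one]
    calc _ ≤ (⨍⁻ x in Q.toSet, ‖f x‖ₑ ∂volume) * e ^ (1 / q) *
          (⨍⁻ x in Q.toSet, ENNReal.ofReal (w x) ^ q ∂volume) ^ (1 / q) := by gcongr
      _ = (e * ⨍⁻ x in Q.toSet, ENNReal.ofReal (w x) ^ q ∂volume) ^ (1 / q) *
          (⨍⁻ x in Q.toSet, ‖f x‖ₑ ∂volume) := by
        rw [ENNReal.mul_rpow_of_nonneg _ _ hqi.le]; ring
      _ ≤ _ := by
        gcongr
        exact le_iSup (fun Q : Cube n => essSup (fun x => ENNReal.ofReal (w x) ^ (-q))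
          (volume.restrict Q.toSet) * ⨍⁻ x in Q.toSet, ENNReal.ofReal (w x) ^ q ∂volume) Q
  · have hp1 : 1 < p := lt_of_le_of_ne hp (Ne.symm h1)
    have hconj : p.HolderConjugate (p / (p - 1)) := Real.HolderConjugate.conjExponent hp1
    have hp' : 0 < p / (p - 1) := hconj.symm.pos
    set s := ⨍⁻ x in Q.toSet, ENNReal.ofReal (w x) ^ (-(p / (p - 1))) ∂volume with hs
    have hle : ⨍⁻ x in Q.toSet, ‖f x‖ₑ * (ENNReal.ofReal (w x))⁻¹ ∂volume ≤
        (⨍⁻ x in Q.toSet, ‖f x‖ₑ ^ p ∂volume) ^ (1 / p) * s ^ (1 / (p / (p - 1))) := by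
      -- Hölder for the normalized measure on `Q`, so that it is already a statement about averages.
      have hH := ENNReal.lintegral_mul_le_Lp_mul_Lq
        ((volume.restrict Q.toSet Set.univ)⁻¹ • volume.restrict Q.toSet) hconj
        (f := fun x => ‖f x‖ₑ) (g := fun x => (ENNReal.ofReal (w x))⁻¹)
        (hf.enorm.restrict.smul_measure _)
        (hw.1.ennreal_ofReal.inv.restrict.smul_measure _)
      simp only [Pi.mul_apply] at hH
      rw [hs]
      simp only [laverage, ENNReal.rpow_neg, ← ENNReal.inv_rpow]
      exact hH
    calc _ ≤ (⨍⁻ x in Q.toSet, ‖f x‖ₑ ^ p ∂volume) ^ (1 / p) * s ^ (1 / (p / (p - 1))) *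
          (⨍⁻ x in Q.toSet, ENNReal.ofReal (w x) ^ q ∂volume) ^ (1 / q) := by gcongr
      _ = ((⨍⁻ x in Q.toSet, ENNReal.ofReal (w x) ^ q ∂volume) *
            s ^ (q / (p / (p - 1)))) ^ (1 / q) *
          (⨍⁻ x in Q.toSet, ‖f x‖ₑ ^ p ∂volume) ^ (1 / p) := by
        rw [ENNReal.mul_rpow_of_nonneg _ _ hqi.le, ← ENNReal.rpow_mul,
          show q / (p / (p - 1)) * (1 / q) = 1 / (p / (p - 1)) by field_simp]
        ring
      _ ≤ _ := by
        gcongr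
        exact le_iSup (fun Q : Cube n => (⨍⁻ x in Q.toSet, ENNReal.ofReal (w x) ^ q ∂volume) *
          (⨍⁻ x in Q.toSet, ENNReal.ofReal (w x) ^ (-(p / (p - 1))) ∂volume) ^
            (q / (p / (p - 1)))) Q

theorem setLIntegral_maximal_le_ainftyChar {u : (Fin n → ℝ) → ℝ≥0∞} {v : (Fin n → ℝ) → ℝ}
    (hv : ∀ᵐ x, 0 ≤ v x) (huv : (fun x => ENNReal.ofReal (v x)) =ᵐ[volume] u) (P : Cube n)
    (h0 : ∫⁻ x in P.toSet, u x ≠ 0) (ht : ∫⁻ x in P.toSet, u x ≠ ∞) :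
    ∫⁻ x in P.toSet, (⨆ R : Cube n, R.toSet.indicator
      (fun _ => ⨍⁻ y in R.toSet, P.toSet.indicator u y ∂volume) x) ≤
      ainftyChar v * ∫⁻ x in P.toSet, u x := by
  rw [← ENNReal.div_le_iff h0 ht]
  refine le_trans (le_of_eq ?_) (le_iSup _ P)
  have h2 : ∫⁻ x in P.toSet, u x = ∫⁻ x in P.toSet, ENNReal.ofReal (v x) :=
    lintegral_congr_ae (ae_restrict_of_ae huv.symm)
  have h3 : (fun y => P.toSet.indicator u y) =ᵐ[volume] fun y => ‖P.toSet.indicator v y‖ₑ := by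
    filter_upwards [hv, huv] with x hx hx'
    by_cases hxP : x ∈ P.toSet
    · simp only [Set.indicator_of_mem hxP]
      rw [Real.enorm_eq_ofReal hx, hx']
    · simp [hxP]
  have h4 : ∀ R : Cube n, ⨍⁻ y in R.toSet, P.toSet.indicator u y ∂volume =
      ⨍⁻ y in R.toSet, ‖P.toSet.indicator v y‖ₑ ∂volume := fun R => R.setLAverage_congr h3
  rw [h2]
  simp only [maximalFn, h4]

/-- On `P` the maximal function of `v χ_P` is at least the average over `P` itself. -/
theorem one_le_ainftyChar {u : (Fin n → ℝ) → ℝ≥0∞} {v : (Fin n → ℝ) → ℝ}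
    (hv : ∀ᵐ x, 0 ≤ v x) (huv : (fun x => ENNReal.ofReal (v x)) =ᵐ[volume] u) (P : Cube n)
    (h0 : ∫⁻ x in P.toSet, u x ≠ 0) (ht : ∫⁻ x in P.toSet, u x ≠ ∞) : 1 ≤ ainftyChar v := by
  refine (ENNReal.mul_le_mul_iff_left h0 ht).1 ?_
  rw [one_mul]
  refine le_trans ?_ (setLIntegral_maximal_le_ainftyChar hv huv P h0 ht)
  calc ∫⁻ x in P.toSet, u x
      = ∫⁻ x in P.toSet, ⨍⁻ y in P.toSet, P.toSet.indicator u y ∂volume := by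
        rw [setLIntegral_const, setLAverage_eq, setLIntegral_indicator P.measurableSet,
          Set.inter_self, ENNReal.div_mul_cancel P.volume_ne_zero P.volume_ne_top]
    _ ≤ _ := by
        refine setLIntegral_mono' P.measurableSet fun x hx => ?_
        refine le_trans (le_of_eq ?_) (le_iSup _ P)
        rw [Set.indicator_of_mem hx]

end Weight

/-! ### Degenerate cases and passage to the full sparse family -/

theorem fractionalSparse_eq_zero {S : Set (Cube n)} {α : ℝ} {g : (Fin n → ℝ) → ℝ≥0∞}
    (h : ∀ Q ∈ S, ⨍⁻ y in Q.toSet, g y ∂volume = 0) (x : Fin n → ℝ) :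
    fractionalSparse S α g x = 0 := by
  rw [fractionalSparse, ENNReal.tsum_eq_zero]
  intro Q
  simp [h Q Q.2]

/-- Rounds a multiple of the `A_∞` characteristic up to an integer; `1 ≤ a` absorbs the rounding
error into the constant. -/
theorem exists_nat_between {c a : ℝ≥0∞} (hc : 1 ≤ c) (hct : c ≠ ∞) (ha : 1 ≤ a) (hat : a ≠ ∞) :
    ∃ N : ℕ, N ≠ 0 ∧ c * a ≤ N ∧ (N : ℝ≥0∞) ≤ (c + 1) * a := by
  have hcat : c * a ≠ ∞ := ENNReal.mul_ne_top hct hat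
  have h1 : c * a ≤ (⌈(c * a).toReal⌉₊ : ℝ≥0∞) := by
    rw [← ENNReal.ofReal_natCast]
    exact (ENNReal.ofReal_toReal hcat).ge.trans (ENNReal.ofReal_le_ofReal (Nat.le_ceil _))
  refine ⟨⌈(c * a).toReal⌉₊, fun h0 => ?_, h1, ?_⟩
  · rw [h0, Nat.cast_zero, nonpos_iff_eq_zero, mul_eq_zero] at h1
    rcases h1 with h1 | h1
    · simp [h1] at hc
    · simp [h1] at ha
  · calc (⌈(c * a).toReal⌉₊ : ℝ≥0∞) ≤ ENNReal.ofReal ((c * a).toReal + 1) := by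
          rw [← ENNReal.ofReal_natCast]
          exact ENNReal.ofReal_le_ofReal (Nat.ceil_lt_add_one ENNReal.toReal_nonneg).le
      _ = c * a + 1 := by
          rw [ENNReal.ofReal_add ENNReal.toReal_nonneg zero_le_one, ENNReal.ofReal_toReal hcat,
            ENNReal.ofReal_one]
      _ ≤ (c + 1) * a := by rw [add_mul, one_mul]; gcongr

end SparseFractional

open SparseFractional in
theorem theorem3p3 (n : ℕ) (α p q : ℝ) (hα : 0 < α) (hαn : α < n) (hp : 1 ≤ p)
    (hpα : p < n / α) (hq : 1 / p - 1 / q = α / n) :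
    ∃ C : ℝ≥0, ∀ (D S : Set (SparseFractional.Cube n)),
      SparseFractional.IsDyadicGrid D → S ⊆ D → SparseFractional.IsSparse S →
      ∀ w : (Fin n → ℝ) → ℝ, SparseFractional.MemApq p q w →
      ∀ f : (Fin n → ℝ) → ℝ, MemLp f (ENNReal.ofReal p) volume → (∀ᵐ x ∂volume, 0 ≤ f x) →
      ∀ l : ℝ, 0 < l →
        volume {x : Fin n → ℝ | ENNReal.ofReal l <
            ENNReal.ofReal (w x) *
              SparseFractional.fractionalSparse S α
                (fun y => ENNReal.ofReal (f y * (w y)⁻¹)) x} ≤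
          (C : ℝ≥0∞) * SparseFractional.apqChar p q w *
            SparseFractional.ainftyChar (fun x => w x ^ q) ^ q *
            (eLpNorm f (ENNReal.ofReal p) volume / ENNReal.ofReal l) ^ q := by
  have hn0 : (0 : ℝ) < n := hα.trans hαn
  have hn : n ≠ 0 := by rintro rfl; simp at hn0
  have hp0 : 0 < p := by linarith
  have hαp : α / n < 1 / p := by
    rw [div_lt_div_iff₀ hn0 hp0, one_mul, mul_comm]
    exact (lt_div_iff₀ hα).1 hpα
  have hq0 : 0 < q := one_div_pos.1 (by linarith)
  have hpq : p < q := by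
    have : 0 < α / n := by positivity
    exact (one_div_lt_one_div hq0 hp0).1 (by linarith)
  have hqi : 0 < 1 / q := by positivity
  have hq1 : 1 < q := by linarith
  set C₀ : ℝ≥0∞ := (sparseConst q * (2 ^ (n + 2) + 1)) ^ q with hC₀
  have hC₀t : C₀ ≠ ∞ := by
    refine ENNReal.rpow_ne_top_of_nonneg hq0.le (ENNReal.mul_ne_top (sparseConst_ne_top hq1) ?_)
    finiteness
  -- The added `1` keeps the constant nonzero, so that the right side really is infinite when the
  -- `A_∞` characteristic is.
  refine ⟨C₀.toNNReal + 1, ?_⟩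
  intro D S hD hSD hS w hw f hf hf0 l hl
  have hCle : C₀ ≤ ((C₀.toNNReal + 1 : ℝ≥0) : ℝ≥0∞) := by
    rw [ENNReal.coe_add, ENNReal.coe_toNNReal hC₀t]; exact le_self_add
  have hC0 : ((C₀.toNNReal + 1 : ℝ≥0) : ℝ≥0∞) ≠ 0 := by simp
  set A := apqChar p q w with hA
  set B := ainftyChar (fun x => w x ^ q) with hB
  set L := ENNReal.ofReal l with hL
  have hL0 : L ≠ 0 := by simpa [hL] using hl
  have hLt : L ≠ ∞ := ENNReal.ofReal_ne_top
  have hfm : AEMeasurable f volume := hf.1.aemeasurable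
  set J := ∫⁻ y, ‖f y‖ₑ ^ p with hJ
  have hnorm : eLpNorm f (ENNReal.ofReal p) volume = J ^ (1 / p) := by
    rw [eLpNorm_eq_lintegral_rpow_enorm_toReal (by simpa using hp0) ENNReal.ofReal_ne_top,
      ENNReal.toReal_ofReal hp0.le]
  have hJt : J ≠ ∞ := by
    intro h
    have := hf.2
    rw [hnorm, h, ENNReal.top_rpow_of_pos (by positivity)] at this
    exact lt_irrefl _ this
  have ht0 : ∀ Q : Cube n, ⨍⁻ x in Q.toSet, ENNReal.ofReal (w x) ^ q ∂volume ≠ 0 := fun Q =>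
    Q.setLAverage_ne_zero (hw.1.aemeasurable_rpow q) (hw.1.ae_rpow_ne_zero q)
  have htt : ∀ Q : Cube n, ⨍⁻ x in Q.toSet, ENNReal.ofReal (w x) ^ q ∂volume ≠ ∞ := fun Q =>
    hw.setLAverage_ne_top hp hq0 Q
  have hHol := hw.1.setLAverage_mul_inv_le hp hq0 hfm hf0
  rw [hnorm]
  -- Here the right side vanishes, even against an infinite `B` because `0 * ∞ = 0`; Hölder then
  -- makes every average of `f w⁻¹` zero.
  by_cases hAJ : A = 0 ∨ J = 0
  · have hz : ∀ Q ∈ S, ⨍⁻ y in Q.toSet, ENNReal.ofReal (f y * (w y)⁻¹) ∂volume = 0 := by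
      intro Q _
      have h := hHol Q
      have hr : apqChar p q w ^ (1 / q) *
          (⨍⁻ x in Q.toSet, ‖f x‖ₑ ^ p ∂volume) ^ (1 / p) = 0 := by
        rcases hAJ with h0 | h0
        · rw [← hA, h0, ENNReal.zero_rpow_of_pos hqi, zero_mul]
        · have : ∫⁻ x in Q.toSet, ‖f x‖ₑ ^ p = 0 :=
            nonpos_iff_eq_zero.1 ((setLIntegral_le_lintegral _ _).trans_eq h0)
          rw [setLAverage_eq, this, ENNReal.zero_div, ENNReal.zero_rpow_of_pos (by positivity),
            mul_zero]
      rw [hr, nonpos_iff_eq_zero, mul_eq_zero] at h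
      refine h.resolve_right ?_
      simp [ht0 Q, htt Q]
    have hempty : {x : Fin n → ℝ | L < ENNReal.ofReal (w x) *
        fractionalSparse S α (fun y => ENNReal.ofReal (f y * (w y)⁻¹)) x} = ∅ := by
      ext x
      simp [fractionalSparse_eq_zero hz]
    rw [hempty, measure_empty]
    exact zero_le
  push Not at hAJ
  obtain ⟨hA0, hJ0⟩ := hAJ
  have hJpt : J ^ (1 / p) / L ≠ 0 := by
    simp [hLt, hJ0, hJt]
  have hJLq : (J ^ (1 / p) / L) ^ q ≠ 0 := by
    rw [Ne, ENNReal.rpow_eq_zero_iff]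
    rintro (⟨h, -⟩ | ⟨-, h⟩)
    · exact hJpt h
    · linarith
  by_cases hBt : B = ∞
  · rw [hBt, ENNReal.top_rpow_of_pos hq0, ENNReal.mul_top (mul_ne_zero hC0 hA0),
      ENNReal.top_mul hJLq]
    exact le_top
  -- The weight is only almost everywhere measurable, while the level set arguments need a
  -- measurable `u`.
  set u : (Fin n → ℝ) → ℝ≥0∞ := fun x => ENNReal.ofReal (hw.1.1.mk w x) ^ q with hu
  have hum : Measurable u := hw.1.1.measurable_mk.ennreal_ofReal.pow_const q
  have hwu : (fun x => ENNReal.ofReal (w x) ^ q) =ᵐ[volume] u := by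
    filter_upwards [hw.1.1.ae_eq_mk] with x hx
    rw [hu, hx]
  have hvu : (fun x => ENNReal.ofReal (w x ^ q)) =ᵐ[volume] u := by
    filter_upwards [hwu, hw.1.2] with x hx hx0
    rw [← hx, ENNReal.ofReal_rpow_of_pos hx0]
  have hv0 : ∀ᵐ x ∂(volume : Measure (Fin n → ℝ)), 0 ≤ w x ^ q := by
    filter_upwards [hw.1.2] with x hx using Real.rpow_nonneg hx.le q
  have huQ : ∀ Q : Cube n, ∫⁻ x in Q.toSet, u x = ∫⁻ x in Q.toSet, ENNReal.ofReal (w x) ^ q :=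
    fun Q => lintegral_congr_ae (ae_restrict_of_ae hwu.symm)
  have hu0 : ∀ Q : Cube n, ∫⁻ x in Q.toSet, u x ≠ 0 := fun Q => by
    rw [huQ]
    exact Q.setLIntegral_ne_zero (hw.1.aemeasurable_rpow q) (hw.1.ae_rpow_ne_zero q)
  have hut : ∀ Q : Cube n, ∫⁻ x in Q.toSet, u x ≠ ∞ := fun Q => by
    rw [huQ]
    exact hw.setLIntegral_ne_top hp hq0 Q
  have hB1 : 1 ≤ B := one_le_ainftyChar hv0 hvu ⟨0, 1, one_pos⟩ (hu0 _) (hut _)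
  obtain ⟨N, hN0, hBN, hNB⟩ := exists_nat_between (c := 2 ^ (n + 2))
    (one_le_pow₀ one_le_two) (by finiteness) hB1 hBt
  have hlevel := fun (Q : Cube n) (hQ : Q ∈ D) => hD.volume_level_le hn hum
    (fun P => setLIntegral_maximal_le_ainftyChar hv0 hvu P (hu0 P) (hut P)) hQ hN0 hBN
    (hut Q) (hu0 Q)
  obtain ⟨E, hE, hdisj⟩ := id hS
  have hScount := hS.countable
  set a : Cube n → ℝ≥0∞ := fun Q => volume Q.toSet ^ (α / (n : ℝ)) *
    ⨍⁻ y in Q.toSet, ENNReal.ofReal (f y * (w y)⁻¹) ∂volume with ha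
  have hfin : ∀ s : Finset S,
      volume {x | L < ENNReal.ofReal (w x) *
        ∑ Q ∈ s, (Q : Cube n).toSet.indicator (fun _ => a Q) x} ≤
      (sparseConst q * N * A ^ (1 / q) * J ^ (1 / p) / L) ^ q := by
    intro s
    have hmem : ∀ Q ∈ s.map (Function.Embedding.subtype _), Q ∈ S := by
      intro Q hQ
      obtain ⟨R, -, rfl⟩ := Finset.mem_map.1 hQ
      exact R.2
    have h := hD.volume_finite_sparse_le hn hp hpq hq (S := s.map (Function.Embedding.subtype _))
      (fun Q hQ => hSD (hmem Q hQ)) (fun Q hQ => hE Q (hmem Q hQ))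
      (hdisj.subset fun Q hQ => hmem Q hQ) (h := fun y => ‖f y‖ₑ ^ p) hJ0 hJt hum
      (t := fun Q => ⨍⁻ x in Q.toSet, u x ∂volume)
      (fun Q _ => by rw [← Q.setLAverage_congr hwu]; exact ht0 Q)
      (fun Q _ => by rw [← Q.setLAverage_congr hwu]; exact htt Q) hN0
      (fun Q hQ k => hlevel Q (hSD (hmem Q hQ)) k) (a := a) (K := A ^ (1 / q))
      (fun Q _ => by
        rw [← Q.setLAverage_congr hwu, ha, fracAvg, mul_left_comm, mul_assoc]
        exact mul_le_mul_right (hHol Q) _) hL0 hLt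
    refine le_trans (le_of_eq ?_) h
    refine measure_congr ?_
    filter_upwards [hwu] with x hx
    refine propext (Iff.of_eq ?_)
    change (L < _) = (L < _)
    rw [Finset.sum_map, ← hx, ← ENNReal.rpow_mul, mul_one_div_cancel hq0.ne', ENNReal.rpow_one]
    rfl
  -- The full sum is the supremum of its finite partial sums and the inequality is strict, so the
  -- level set is the directed union of those of finite subfamilies, whose bound is uniform.
  have hunion : {x : Fin n → ℝ | L < ENNReal.ofReal (w x) *
        fractionalSparse S α (fun y => ENNReal.ofReal (f y * (w y)⁻¹)) x} ⊆
      ⋃ s : Finset S, {x | L < ENNReal.ofReal (w x) *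
        ∑ Q ∈ s, (Q : Cube n).toSet.indicator (fun _ => a Q) x} := by
    intro x hx
    have hx' : L < ENNReal.ofReal (w x) *
        fractionalSparse S α (fun y => ENNReal.ofReal (f y * (w y)⁻¹)) x := hx
    rw [fractionalSparse, ENNReal.tsum_eq_iSup_sum, ENNReal.mul_iSup, lt_iSup_iff] at hx'
    exact Set.mem_iUnion.2 hx'
  have hdir : Directed (· ⊆ ·) fun s : Finset S => {x | L < ENNReal.ofReal (w x) *
        ∑ Q ∈ s, (Q : Cube n).toSet.indicator (fun _ => a Q) x} := by
    refine directed_of_isDirected_le fun s s' hss' x hx => ?_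
    have hx' : L < ENNReal.ofReal (w x) *
        ∑ Q ∈ s, (Q : Cube n).toSet.indicator (fun _ => a Q) x := hx
    exact hx'.trans_le (mul_le_mul_right (Finset.sum_le_sum_of_subset hss') _)
  have : Countable S := hScount.to_subtype
  calc volume {x : Fin n → ℝ | L < ENNReal.ofReal (w x) *
        fractionalSparse S α (fun y => ENNReal.ofReal (f y * (w y)⁻¹)) x}
      ≤ (sparseConst q * N * A ^ (1 / q) * J ^ (1 / p) / L) ^ q := by
        refine (measure_mono hunion).trans ?_
        rw [hdir.measure_iUnion]
        exact iSup_le hfin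
    _ ≤ (sparseConst q * ((2 ^ (n + 2) + 1) * B) * A ^ (1 / q) * J ^ (1 / p) / L) ^ q := by
        gcongr
    _ = ((sparseConst q * (2 ^ (n + 2) + 1)) * A ^ (1 / q) * B * (J ^ (1 / p) / L)) ^ q := by
        rw [mul_div_assoc]
        congr 1
        ring
    _ = C₀ * A * B ^ q * (J ^ (1 / p) / L) ^ q := by
        rw [ENNReal.mul_rpow_of_nonneg _ _ hq0.le, ENNReal.mul_rpow_of_nonneg _ _ hq0.le,
          ENNReal.mul_rpow_of_nonneg _ _ hq0.le, ← ENNReal.rpow_mul, one_div_mul_cancel hq0.ne',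
          ENNReal.rpow_one]
    _ ≤ _ := by gcongr
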